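/- **Setting.** Let $d\ge 1$, $N\in\mathbb N$, let $D\subset\mathbb R^d$ be a bounded domain, $Y=(0,1)^d$, $V=H^1_0(D)$ and $f\in V'$. Write $C(\bar D,C_\#(\bar Y))$ for the continuous functions $g(x,y)$ of $x\in\bar D$, $y\in\mathbb R^d$ that are $1$-periodic in each coordinate of $y$. Let $A^*,\bar A,\psi_1,\psi_2,\ldots\in C(\bar D,C_\#(\bar Y))$ with $A^*\ge 0$ on $D\times Y$, put $b_j=\sup_{x\in D,y\in Y}|\psi_j(x,y)|$ and assume $\sum_j b_j<\infty$. Let $\ell_1,\ldots,\ell_N\in C(\bar D,C_\#(\bar Y))^d$, and let $\Sigma$ be a symmetric positive definite $N\times N$ matrix; write $|v|_\Sigma^2=v\cdot\Sigma^{-1}v$ and let $|\cdot|$ be the Euclidean norm. Let $$U=\Big\{z\in\mathbb R^{\mathbb N}:\ \sum_{j}|z_j|b_j<\infty\Big\},$$ with the $\sigma$-algebra induced by the product Borel $\sigma$-algebra of $\mathbb R^{\mathbb N}$, and let $\rho$ be the restriction to $U$ of $\bigotimes_j\mathcal N(0,1)$. For $z\in U$ put $$A(z;x,y)=A^*(x,y)+\exp\Big(\bar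 A(x,y)+\sum_{j}z_j\psi_j(x,y)\Big).$$ For $\varepsilon>0$ let $u^\varepsilon(z)\in V$ be the weak solution of $$-\nabla\cdot\big(A(z;x,x/\varepsilon)\nabla u^\varepsilon(z;x)\big)=f\ \text{ in } D,\qquad u^\varepsilon=0\ \text{ on }\partial D,$$ let $\mathcal G^\varepsilon(z)=\big(\int_D\ell_i(x,x/\varepsilon)\cdot\nabla u^\varepsilon(z;x)\,dx\big)_{i=1}^N\in\mathbb R^N$ and $\Phi^\varepsilon(z,\delta)=\frac12|\delta-\mathcal G^\varepsilon(z)|_\Sigma^2$. The observation is $\delta=\mathcal G^\varepsilon(z)+\nu$, where $z\sim\rho$ and $\nu\sim\mathcal N(0,\Sigma)$ are independent. For measures $\mu,\mu'$ on $U$ that are absolutely continuous with respect to $\rho$, $$d_{\rm Hell}(\mu,\mu')=\Big(\tfrac12\int_U\Big(\sqrt{\tfrac{d\mu}{d\rho}}-\sqrt{\tfrac{d\mu'}{d\rho}}\Big)^2d\rho\Big)^{1/2}.$$ **Proposition 5.1 (Gaussian prior well-posedness).** 1. $U$ is measurable and has measure $1$ under $\bigotimes_j\mathcal N(0,1)$,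 so that $\rho$ is a probability measure on $U$. 2. For all $\varepsilon>0$ and $z\in U$ the problem for $u^\varepsilon(z)$ has exactly one weak solution in $V$, and the forward map $\mathcal G^\varepsilon:U\to\mathbb R^N$ is measurable. 3. For every $\varepsilon>0$ the posterior $\rho^{\delta,\varepsilon}=\mathbb P(z\mid\delta)$ is determined by the Bayes formula $$\frac{d\rho^{\delta,\varepsilon}}{d\rho}(z)=\frac{\exp(-\Phi^\varepsilon(z,\delta))}{Z^\varepsilon(\delta)},\qquad Z^\varepsilon(\delta)=\int_U\exp(-\Phi^\varepsilon(z,\delta))\,d\rho(z).$$ That is, $Z^\varepsilon(\delta)>0$ for all $\delta\in\mathbb R^N$, the measures $\rho^{\delta,\varepsilon}$ given by this formula form a regular conditional distribution of $z$ given $\delta$, and every regular conditional distribution of $z$ given $\delta$ coincides with $\rho^{\delta,\varepsilon}$ for almost all $\delta$ with respect to the law of $\delta$. 4. For every $r>0$ there is a constant $c(r)$, independent of $\varepsilon$, such that for all $\varepsilon>0$ and all $\delta,\delta'\in\mathbb R^N$ with $|\delta|\le r$ and $|\delta'|\le r$, $$d_{\rm Hell}(\rho^{\delta,\varepsilon},\rho^{\delta',\varepsilon})\le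 c(r)\,|\delta-\delta'|.$$ -/

import Mathlib

open MeasureTheory ProbabilityTheory Set
open scoped ENNReal ContDiff Matrix

noncomputable section

namespace TwoScale

/-- Euclidean space `ℝⁿ`. -/
abbrev E (n : ℕ) : Type := EuclideanSpace ℝ (Fin n)

/-! ### The space `H¹₀(D)` -/

/-- `L²(D; ℝ) × L²(D; ℝᵈ)` with the Hilbert norm `(‖u‖² + ‖g‖²)^(1/2)`. -/
abbrev L2Pair {d : ℕ} (D : Set (E d)) : Type :=
  WithLp 2 (Lp ℝ 2 (volume.restrict D) × Lp (E d) 2 (volume.restrict D))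

/-- The pairs `(φ, ∇φ)` with `φ ∈ C_c^∞(D)`. -/
def testPairs {d : ℕ} (D : Set (E d)) : Submodule ℝ (L2Pair D) where
  carrier := {p | ∃ φ : E d → ℝ, ContDiff ℝ ∞ φ ∧ HasCompactSupport φ ∧ tsupport φ ⊆ D ∧
    p.fst =ᵐ[volume.restrict D] φ ∧ p.snd =ᵐ[volume.restrict D] gradient φ}
  zero_mem' := by
    refine ⟨0, contDiff_const, HasCompactSupport.zero, by simp [tsupport], ?_, ?_⟩
    · exact Lp.coeFn_zero _ _ _
    · filter_upwards [Lp.coeFn_zero (E d) 2 (volume.restrict D)] with x hx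
      change (0 : Lp (E d) 2 (volume.restrict D)) x = gradient (0 : E d → ℝ) x
      rw [hx]
      simp [gradient]
  add_mem' := by
    rintro p q ⟨φ, h1, h2, h3, h4, h5⟩ ⟨χ, k1, k2, k3, k4, k5⟩
    refine ⟨φ + χ, h1.add k1, h2.add k2,
      (tsupport_add φ χ).trans (union_subset h3 k3), ?_, ?_⟩
    · filter_upwards [Lp.coeFn_add p.fst q.fst, h4, k4] with x hx a b
      change (p.fst + q.fst) x = _
      rw [hx, Pi.add_apply, Pi.add_apply, a, b]
    · filter_upwards [Lp.coeFn_add p.snd q.snd, h5, k5] with x hx a b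
      change (p.snd + q.snd) x = _
      rw [hx, Pi.add_apply, a, b]
      simp only [gradient]
      rw [fderiv_add (h1.differentiable (by simp) x) (k1.differentiable (by simp) x), map_add]
  smul_mem' := by
    rintro c p ⟨φ, h1, h2, h3, h4, h5⟩
    refine ⟨c • φ, h1.const_smul c, h2.smul_left, ?_, ?_, ?_⟩
    · exact (tsupport_smul_subset_right (fun _ => c) φ).trans h3
    · filter_upwards [Lp.coeFn_smul c p.fst, h4] with x hx a
      change (c • p.fst) x = _
      simp [hx, a]
    · filter_upwards [Lp.coeFn_smul c p.snd, h5] with x hx a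
      change (c • p.snd) x = _
      rw [hx, Pi.smul_apply, a]
      simp only [gradient]
      rw [fderiv_const_smul (h1.differentiable (by simp) x), map_smul]

/-- `V = H¹₀(D)`: the closure of `C_c^∞(D)` in the `H¹` norm. A member `u` is carried together
with its weak gradient: `u.1.fst` is the function and `u.1.snd` its gradient. -/
def H10 {d : ℕ} (D : Set (E d)) : Submodule ℝ (L2Pair D) := (testPairs D).topologicalClosure

/-- The gradient `∇u` of `u ∈ H¹₀(D)`. -/
def grad {d : ℕ} {D : Set (E d)} (u : H10 D) : E d → E d := u.1.snd

/-- `u ∈ H¹₀(D)` is the weak solution of `-∇·(a ∇u) = f`, `u = 0` on `∂D`: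
`∫_D a ∇u · ∇v dx = f(v)` for all `v ∈ H¹₀(D)`. -/
def IsWeakSolution {d : ℕ} {D : Set (E d)} (a : E d → ℝ) (f : StrongDual ℝ (H10 D))
    (u : H10 D) : Prop :=
  ∀ v : H10 D, ∫ x in D, a x * inner ℝ (grad u x) (grad v x) = f v

/-! ### The two scale coefficient and the inverse problem -/

/-- The open unit cube `Y = (0,1)ᵈ`. -/
def unitCube (d : ℕ) : Set (E d) := {y | ∀ i, y i ∈ Ioo (0 : ℝ) 1}

/-- `g ∈ C(D̄, C_#(Ȳ))`: `g(x,y)` is jointly continuous for `x ∈ D̄`, `y ∈ ℝᵈ`, and `1`-periodic in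
each coordinate of `y`. -/
structure IsContPeriodic {d : ℕ} {F : Type*} [TopologicalSpace F] (D : Set (E d))
    (g : E d → E d → F) : Prop where
  continuousOn : ContinuousOn (fun p : E d × E d => g p.1 p.2) (closure D ×ˢ univ)
  periodic : ∀ x ∈ closure D, ∀ y : E d, ∀ i : Fin d,
    g x (y + EuclideanSpace.single i 1) = g x y

/-- `sup_{x ∈ D, y ∈ Y} |g(x,y)|`. -/
def supAbs {d : ℕ} (D : Set (E d)) (g : E d → E d → ℝ) : ℝ :=
  sSup ((fun p : E d × E d => |g p.1 p.2|) '' (D ×ˢ unitCube d))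

/-- The data of the inverse problem with log-Gaussian prior, and the standing assumptions on
them. -/
structure GaussianProblem (d N : ℕ) where
  d_pos : 0 < d
  /-- the bounded domain -/
  D : Set (E d)
  D_open : IsOpen D
  D_connected : IsConnected D
  D_bounded : Bornology.IsBounded D
  /-- the right hand side, in `V' = H⁻¹(D)` -/
  f : StrongDual ℝ (H10 D)
  /-- the nonnegative part `A^*` of the coefficient -/
  Astar : E d → E d → ℝ
  Astar_mem : IsContPeriodic D Astar
  Astar_nonneg : ∀ x ∈ D, ∀ y ∈ unitCube d, 0 ≤ Astar x y
  /-- the mean `Ā` of the logarithm -/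
  Abar : E d → E d → ℝ
  Abar_mem : IsContPeriodic D Abar
  /-- the functions `ψ_j` of the expansion -/
  psi : ℕ → E d → E d → ℝ
  psi_mem : ∀ j, IsContPeriodic D (psi j)
  psi_summable : Summable fun j => supAbs D (psi j)
  /-- the functions `ℓ_i` of the observations -/
  ell : Fin N → E d → E d → E d
  ell_mem : ∀ i, IsContPeriodic D (ell i)
  /-- the covariance matrix `Σ` of the observation noise -/
  cov : Matrix (Fin N) (Fin N) ℝ
  cov_posDef : cov.PosDef

/-- The product measure `⨂_j N(0,1)` on `ℝ^ℕ`. -/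
def gaussianSeq : Measure (ℕ → ℝ) := Measure.infinitePi fun _ : ℕ => gaussianReal 0 1

namespace GaussianProblem

variable {d N : ℕ} (P : GaussianProblem d N)

/-- The set `U` of the sequences `z` with `∑_j |z_j| sup |ψ_j| < ∞`. -/
def U : Set (ℕ → ℝ) := {z | Summable fun j => |z j| * supAbs P.D (P.psi j)}

/-- The prior `ρ`: the restriction of `⨂_j N(0,1)` to the space `U`. -/
def prior : Measure P.U := gaussianSeq.comap Subtype.val

/-- `A(z;x,y) = A^*(x,y) + exp(Ā(x,y) + ∑_j z_j ψ_j(x,y))`. -/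
def coeff (z : ℕ → ℝ) (x y : E d) : ℝ :=
  P.Astar x y + Real.exp (P.Abar x y + ∑' j, z j * P.psi j x y)

/-- `u` solves the two scale problem with the coefficient `A^ε(z;x) = A(z;x,x/ε)`. -/
def IsForwardSolution (ε : ℝ) (z : P.U) (u : H10 P.D) : Prop :=
  IsWeakSolution (fun x => P.coeff z.1 x (ε⁻¹ • x)) P.f u

open Classical in
/-- The solution `u^ε(z)` of the two scale problem (with value `0` if there were none). -/
def solution (ε : ℝ) (z : P.U) : H10 P.D :=
  if h : ∃ u, P.IsForwardSolution ε z u then h.choose else 0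

/-- The forward map `G^ε(z) = (∫_D ℓ_i(x,x/ε)·∇u^ε(z;x) dx)_{i=1,…,N}`. -/
def forward (ε : ℝ) (z : P.U) : E N :=
  WithLp.toLp 2 fun i => ∫ x in P.D, inner ℝ (P.ell i x (ε⁻¹ • x)) (grad (P.solution ε z) x)

/-- `|v|_Σ² = v · Σ⁻¹ v`. -/
def sigmaNormSq (v : E N) : ℝ := v.ofLp ⬝ᵥ (P.cov⁻¹ *ᵥ v.ofLp)

/-- The misfit `Φ^ε(z,δ) = ½ |δ - G^ε(z)|_Σ²`. -/
def misfit (ε : ℝ) (z : P.U) (δ : E N) : ℝ := 1 / 2 * P.sigmaNormSq (δ - P.forward ε z)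

/-- The normalizing constant `Z^ε(δ) = ∫_U exp(-Φ^ε(z,δ)) dρ(z)`. -/
def normConst (ε : ℝ) (δ : E N) : ℝ := ∫ z, Real.exp (-P.misfit ε z δ) ∂P.prior

/-- The measure given by the Bayes formula: its density with respect to `ρ` is
`exp(-Φ^ε(z,δ)) / Z^ε(δ)`. -/
def bayesMeasure (ε : ℝ) (δ : E N) : Measure P.U :=
  P.prior.withDensity fun z =>
    ENNReal.ofReal (Real.exp (-P.misfit ε z δ) / P.normConst ε δ)

/-- The joint law of the unknown `z ∼ ρ` and the independent noise `ν ∼ N(0,Σ)`. -/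
def jointLaw : Measure (P.U × E N) := P.prior.prod (multivariateGaussian 0 P.cov)

/-- The noisy observation `δ = G^ε(z) + ν`. -/
def observation (ε : ℝ) (p : P.U × E N) : E N := P.forward ε p.1 + p.2

/-- `κ` is a posterior `P(z | δ)`: a regular conditional distribution of `z` given the
observation `δ = G^ε(z) + ν`. -/
def IsPosterior (ε : ℝ) (κ : Kernel (E N) P.U) : Prop :=
  IsMarkovKernel κ ∧ HasCondDistrib Prod.fst (P.observation ε) κ P.jointLaw

/-- The Hellinger distance
`(½ ∫_U (√(dμ/dρ) - √(dμ'/dρ))² dρ)^(1/2)` of two measures on `U`. -/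
def hellinger (μ μ' : Measure P.U) : ℝ :=
  Real.sqrt (1 / 2 * ∫ z, (Real.sqrt (μ.rnDeriv P.prior z).toReal
    - Real.sqrt (μ'.rnDeriv P.prior z).toReal) ^ 2 ∂P.prior)

end GaussianProblem

end TwoScale

end

/-! Everything is controlled by the weight `∑ |z_j| b_j` of a sequence. Its expectation under the
product Gaussian is `E|ξ| ∑ b_j < ∞`, hence it is almost surely finite and `U` has full measure. For
`z ∈ U` the coefficient is bounded below by `exp(-(B + weight z))`, where `B` bounds `|Ā|`, whatever
the scale. The Poincaré inequality and Lax–Milgram give the solution, with energy bound of order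
`exp(B + weight z)`. Subtracting two weak formulations shows that the forward map is locally
Lipschitz in the weighted distance (`exists_norm_forward_le`), with constants free of `ε`.
Measurability follows by truncating `z`: the truncated maps are continuous in finitely many
coordinates and converge pointwise.

For Bayes' formula the noise has a Lebesgue density `c exp(-|v|_Σ²/2)`. Translation invariance turns
the joint law of `(δ, z)` into one with density `c exp(-Φ)`, and normalizing in `z` gives the kernel
(`map_observation_eq_compProd`). Uniqueness is that of disintegrations.

For the Hellinger estimate, the square root of the likelihood is `exp(-‖W(δ - G)‖²/4)` with `W =
Σ^(-1/2)`. Since `t ↦ exp(-t²/4)` is 1-Lipschitz, this is Lipschitz in `δ` uniformly in `z` and `ε`,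
so no moments of the forward map are needed. The bound on the forward map enters only through the
lower bound of the normalizing constant (`exists_le_normConst`). -/

namespace ProbabilityTheory

/-! ### Lebesgue densities of Gaussian measures -/

variable {ι : Type*} [Fintype ι]

/-- The density of the standard Gaussian measure on `ℝ^ι`. -/
theorem pi_gaussianReal_eq_withDensity :
    Measure.pi (fun _ : ι => gaussianReal 0 1) =
      volume.withDensity fun x : ι → ℝ => ENNReal.ofReal (∏ i, gaussianPDFReal 0 1 (x i)) := by
  refine Measure.pi_eq fun s hs => ?_
  rw [withDensity_apply _ (MeasurableSet.univ_pi hs), volume_pi, Measure.restrict_pi_pi,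
    ← ofReal_integral_eq_lintegral_ofReal, integral_fintype_prod_eq_prod,
    ENNReal.ofReal_prod_of_nonneg]
  · refine Finset.prod_congr rfl fun i _ => ?_
    rw [gaussianReal_apply_eq_integral _ one_ne_zero]
  · exact fun i _ => integral_nonneg fun x => gaussianPDFReal_nonneg _ _ _
  · exact Integrable.fintype_prod fun i => (integrable_gaussianPDFReal 0 1).restrict
  · exact ae_of_all _ fun x => Finset.prod_nonneg fun i _ => gaussianPDFReal_nonneg _ _ _

theorem prod_gaussianPDFReal (x : ι → ℝ) :
    ∏ i, gaussianPDFReal 0 1 (x i) =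
      (√(2 * Real.pi))⁻¹ ^ Fintype.card ι * Real.exp (-(1 / 2 * ∑ i, x i ^ 2)) := by
  simp only [gaussianPDFReal, Finset.prod_mul_distrib, ← Real.exp_sum]
  simp [Finset.mul_sum, ← Finset.sum_neg_distrib, div_eq_inv_mul]

theorem lintegral_stdGaussian {h : EuclideanSpace ℝ ι → ℝ≥0∞} (hh : Measurable h) :
    ∫⁻ x, h x ∂(stdGaussian (EuclideanSpace ℝ ι)) =
      ∫⁻ x, ENNReal.ofReal ((√(2 * Real.pi))⁻¹ ^ Fintype.card ι *
        Real.exp (-(1 / 2 * ‖x‖ ^ 2))) * h x := by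
  rw [← map_pi_eq_stdGaussian, lintegral_map hh (by fun_prop), pi_gaussianReal_eq_withDensity,
    lintegral_withDensity_eq_lintegral_mul _ (by fun_prop) (by fun_prop),
    ← (PiLp.volume_preserving_toLp ι).lintegral_comp (by fun_prop)]
  simp [prod_gaussianPDFReal, EuclideanSpace.real_norm_sq_eq]

variable [DecidableEq ι]

open scoped MatrixOrder in
theorem _root_.Matrix.PosDef.isUnit_sqrt {S : Matrix ι ι ℝ} (hS : S.PosDef) :
    IsUnit (CFC.sqrt S).det := by
  have h := CFC.sqrt_mul_sqrt_self S hS.posSemidef.nonneg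
  have h2 : IsUnit S.det := (Matrix.isUnit_iff_isUnit_det S).1 hS.isUnit
  rw [← h, Matrix.det_mul] at h2
  exact isUnit_of_mul_isUnit_left h2

open scoped MatrixOrder in
/-- The inverse square root of a positive definite matrix whitens its quadratic form. -/
theorem _root_.Matrix.PosDef.norm_sq_inv_sqrt {S : Matrix ι ι ℝ} (hS : S.PosDef)
    (v : EuclideanSpace ℝ ι) :
    ‖Matrix.toEuclideanCLM (𝕜 := ℝ) (CFC.sqrt S)⁻¹ v‖ ^ 2 = v.ofLp ⬝ᵥ (S⁻¹ *ᵥ v.ofLp) := by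
  have hsa : IsSelfAdjoint (CFC.sqrt S)⁻¹ := by
    have h : (CFC.sqrt S).IsHermitian := (CFC.sqrt_nonneg S).isSelfAdjoint
    exact h.inv
  have h : (CFC.sqrt S)⁻¹ * (CFC.sqrt S)⁻¹ = S⁻¹ := by
    rw [← Matrix.mul_inv_rev, CFC.sqrt_mul_sqrt_self S hS.posSemidef.nonneg]
  rw [← real_inner_self_eq_norm_sq, ← h, ← Matrix.inner_toEuclideanCLM, map_mul,
    mul_apply_eq_comp, ← ContinuousLinearMap.adjoint_inner_left,
    (hsa.map (Matrix.toEuclideanCLM (𝕜 := ℝ))).adjoint_eq, real_inner_comm]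

open scoped MatrixOrder in
/-- The Lebesgue density of the centred Gaussian measure with covariance matrix `S`. -/
theorem exists_multivariateGaussian_eq_withDensity {S : Matrix ι ι ℝ} (hS : S.PosDef) :
    ∃ c : ℝ, 0 < c ∧ multivariateGaussian 0 S = volume.withDensity fun v =>
      ENNReal.ofReal (c * Real.exp (-(1 / 2 * (v.ofLp ⬝ᵥ (S⁻¹ *ᵥ v.ofLp))))) := by
  set L := Matrix.toEuclideanCLM (𝕜 := ℝ) (CFC.sqrt S) with hL
  set K := Matrix.toEuclideanCLM (𝕜 := ℝ) (CFC.sqrt S)⁻¹ with hK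
  have hKL : ∀ x, K (L x) = x := fun x => by
    rw [hK, hL, ← mul_apply_eq_comp, ← map_mul, Matrix.nonsing_inv_mul _ hS.isUnit_sqrt]
    simp
  have hdet : LinearMap.det (L : EuclideanSpace ℝ ι →ₗ[ℝ] EuclideanSpace ℝ ι) ≠ 0 := by
    have h : (K : EuclideanSpace ℝ ι →ₗ[ℝ] EuclideanSpace ℝ ι) ∘ₗ
        (L : EuclideanSpace ℝ ι →ₗ[ℝ] EuclideanSpace ℝ ι) = LinearMap.id := by
      ext x : 1
      exact hKL x
    intro h0
    have := congrArg LinearMap.det h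
    rw [LinearMap.det_comp, h0] at this
    simp at this
  set c₀ : ℝ := (√(2 * Real.pi))⁻¹ ^ Fintype.card ι
  set e : ℝ := |(LinearMap.det (L : EuclideanSpace ℝ ι →ₗ[ℝ] EuclideanSpace ℝ ι))⁻¹|
  have he : 0 < e := abs_pos.2 (inv_ne_zero hdet)
  refine ⟨e * c₀, by positivity, ?_⟩
  -- Change of variables `v = L x`: the image of Lebesgue measure under `L` is `e` times Lebesgue
  -- measure, which is where the factor `e` in the constant comes from.
  have hmap := Measure.map_linearMap_addHaar_eq_smul_addHaar
    (volume : Measure (EuclideanSpace ℝ ι)) hdet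
  refine Measure.ext_of_lintegral _ fun h hh => ?_
  have hq : (fun v : EuclideanSpace ℝ ι => ENNReal.ofReal (e * c₀ *
      Real.exp (-(1 / 2 * (v.ofLp ⬝ᵥ (S⁻¹ *ᵥ v.ofLp)))))) = fun v => ENNReal.ofReal e *
      ENNReal.ofReal (c₀ * Real.exp (-(1 / 2 * ‖K v‖ ^ 2))) := by
    funext v
    rw [hS.norm_sq_inv_sqrt, mul_assoc, ENNReal.ofReal_mul he.le]
  rw [hq, lintegral_withDensity_eq_lintegral_mul _ (by fun_prop) hh, multivariateGaussian,
    lintegral_map hh (by fun_prop), lintegral_stdGaussian (by fun_prop)]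
  simp only [Pi.mul_apply, zero_add, mul_assoc]
  rw [lintegral_const_mul _ (by fun_prop), ← smul_eq_mul (ENNReal.ofReal e),
    ← lintegral_smul_measure, ← hmap,
    lintegral_map (by fun_prop) (by fun_prop)]
  simp only [ContinuousLinearMap.coe_coe, hKL]
  rfl

end ProbabilityTheory

namespace TwoScale

open Filter Topology

/-! ### Reduction of periodic functions to the unit cube -/

section Periodic

variable {d : ℕ} {F : Type*} [TopologicalSpace F] {D : Set (E d)} {g : E d → E d → F}

theorem IsContPeriodic.add_zsmul_single (hg : IsContPeriodic D g) {x : E d} (hx : x ∈ closure D)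
    (i : Fin d) (n : ℤ) (y : E d) : g x (y + n • EuclideanSpace.single i 1) = g x y := by
  have h : Function.Periodic (g x) (EuclideanSpace.single i (1 : ℝ)) := fun y => hg.periodic x hx y i
  exact h.zsmul n y

theorem IsContPeriodic.add_sum_zsmul_single (hg : IsContPeriodic D g) {x : E d}
    (hx : x ∈ closure D) (n : Fin d → ℤ) (s : Finset (Fin d)) (y : E d) :
    g x (y + ∑ i ∈ s, n i • EuclideanSpace.single i (1 : ℝ)) = g x y := by
  classical
  induction s using Finset.induction_on generalizing y with
  | empty => simp
  | insert i s hi ih => rw [Finset.sum_insert hi, ← add_assoc, ih, hg.add_zsmul_single hx]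

/-- Every value of a periodic function is attained on the half open unit cube. -/
theorem IsContPeriodic.exists_mem_Ico (hg : IsContPeriodic D g) {x : E d}
    (hx : x ∈ closure D) (y : E d) : ∃ y', (∀ i, y' i ∈ Ico (0 : ℝ) 1) ∧ g x y' = g x y := by
  refine ⟨y + ∑ i, (-⌊y i⌋) • EuclideanSpace.single i (1 : ℝ), fun j => ?_,
    hg.add_sum_zsmul_single hx _ _ _⟩
  have : (y + ∑ i, (-⌊y i⌋) • EuclideanSpace.single i (1 : ℝ)) j = Int.fract (y j) := by
    simp [Finset.sum_apply, Pi.single_apply, Int.fract, sub_eq_add_neg]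
  rw [this]
  exact ⟨Int.fract_nonneg _, Int.fract_lt_one _⟩

theorem IsContPeriodic.continuous_right (hg : IsContPeriodic D g) {x : E d}
    (hx : x ∈ closure D) : Continuous (g x) :=
  hg.continuousOn.comp_continuous (f := fun y : E d => (x, y)) (by fun_prop) fun _ => ⟨hx, trivial⟩

/-- Periodicity only reaches the half open cube, while the assumptions on the data speak of the open
one. Continuity closes the gap, which is why `C` has to be closed. -/
theorem IsContPeriodic.mem_of_forall_unitCube (hg : IsContPeriodic D g) {x : E d}
    (hx : x ∈ closure D) {C : Set F} (hC : IsClosed C) (h : ∀ y ∈ unitCube d, g x y ∈ C)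
    (y : E d) : g x y ∈ C := by
  obtain ⟨y', hy', hyy⟩ := hg.exists_mem_Ico hx y
  rw [← hyy]
  -- The segment from `y'` to the centre of the cube; it is inside the open cube for `0 < t < 1`.
  let w : ℝ → E d := fun t => WithLp.toLp 2 fun i => (1 - t) * y' i + t * (1 / 2)
  have hw : Continuous w := by fun_prop
  have hw0 : w 0 = y' := by
    ext i
    simp [w]
  have hlim : Tendsto (fun t => g x (w t)) (𝓝[>] 0) (𝓝 (g x y')) := by
    have := ((hg.continuous_right hx).comp hw).tendsto 0
    simp only [Function.comp_apply, hw0] at this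
    exact this.mono_left nhdsWithin_le_nhds
  refine hC.mem_of_tendsto hlim ?_
  filter_upwards [Ioo_mem_nhdsGT (zero_lt_one' ℝ)] with t ht
  refine h _ fun i => ?_
  obtain ⟨h0, h1⟩ := hy' i
  obtain ⟨t0, t1⟩ := ht
  constructor
  · change 0 < (1 - t) * y' i + t * (1 / 2)
    nlinarith [mul_nonneg (sub_nonneg.2 t1.le) h0]
  · change (1 - t) * y' i + t * (1 / 2) < 1
    nlinarith [mul_le_mul_of_nonneg_left h1.le (sub_nonneg.2 t1.le)]

end Periodic

/-! ### Uniform bounds for continuous periodic functions -/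

section Bounds

variable {d : ℕ} {D : Set (E d)}

theorem IsContPeriodic.exists_norm_le {F : Type*} [NormedAddCommGroup F] {g : E d → E d → F}
    (hg : IsContPeriodic D g) (hD : Bornology.IsBounded D) :
    ∃ M, 0 ≤ M ∧ ∀ x ∈ closure D, ∀ y, ‖g x y‖ ≤ M := by
  have hK : IsCompact (WithLp.toLp 2 '' (univ.pi fun _ : Fin d => Icc (0 : ℝ) 1) : Set (E d)) :=
    (isCompact_univ_pi fun _ => isCompact_Icc).image (by fun_prop)
  obtain ⟨M, hM⟩ := (hD.isCompact_closure.prod hK).exists_bound_of_continuousOn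
    (hg.continuousOn.mono (prod_mono_right (subset_univ _)))
  refine ⟨max M 0, le_max_right _ _, fun x hx y => ?_⟩
  obtain ⟨y', hy', hyy⟩ := hg.exists_mem_Ico hx y
  rw [← hyy]
  exact (hM (x, y') ⟨hx, y'.ofLp, fun i _ => Ico_subset_Icc_self (hy' i), rfl⟩).trans
    (le_max_left _ _)

theorem supAbs_nonneg (D : Set (E d)) (g : E d → E d → ℝ) : 0 ≤ supAbs D g := by
  refine Real.sSup_nonneg ?_
  rintro _ ⟨p, -, rfl⟩
  exact abs_nonneg _

theorem IsContPeriodic.abs_le_supAbs {g : E d → E d → ℝ} (hg : IsContPeriodic D g)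
    (hD : Bornology.IsBounded D) {x : E d} (hx : x ∈ D) (y : E d) : |g x y| ≤ supAbs D g := by
  obtain ⟨M, -, hM⟩ := hg.exists_norm_le hD
  refine hg.mem_of_forall_unitCube (subset_closure hx)
    (isClosed_le continuous_abs continuous_const : IsClosed {t : ℝ | |t| ≤ supAbs D g})
    (fun y hy => ?_) y
  -- A real supremum is meaningful only for a set bounded above; `M` provides the bound.
  refine le_csSup ⟨M, ?_⟩ ⟨(x, y), ⟨hx, hy⟩, rfl⟩
  rintro _ ⟨p, hp, rfl⟩
  exact hM p.1 (subset_closure hp.1) p.2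

/-- The function `x ↦ g(x, x/ε)` is continuous on `D`. -/
theorem IsContPeriodic.continuousOn_twoScale {F : Type*} [TopologicalSpace F] {g : E d → E d → F}
    (hg : IsContPeriodic D g) (c : ℝ) : ContinuousOn (fun x => g x (c • x)) D :=
  hg.continuousOn.comp (f := fun x : E d => (x, c • x)) (by fun_prop)
    fun _ hx => ⟨subset_closure hx, trivial⟩

end Bounds

/-! ### The Poincaré inequality -/

section Poincare

variable {d : ℕ} {D : Set (E d)}

/-- Integration by parts of `φ²` against a coordinate function. -/
theorem integral_sq_eq_neg_integral {φ : E d → ℝ} (h1 : ContDiff ℝ ∞ φ)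
    (h2 : HasCompactSupport φ) (i : Fin d) :
    ∫ x, φ x * φ x = -∫ x, φ x * (2 * x i * fderiv ℝ φ x (EuclideanSpace.single i 1)) := by
  have hc := h1.continuous
  have hfd : Continuous fun x => fderiv ℝ φ x (EuclideanSpace.single i (1 : ℝ)) :=
    (h1.continuous_fderiv (by simp)).clm_apply continuous_const
  have hd : ∀ x, DifferentiableAt ℝ φ x := fun x => h1.differentiable (by simp) x
  have hder : ∀ x, fderiv ℝ (fun x => φ x * φ x) x (EuclideanSpace.single i 1) =
      2 * (φ x * fderiv ℝ φ x (EuclideanSpace.single i 1)) := fun x => by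
    rw [fderiv_fun_mul (hd x) (hd x)]
    simp
    ring
  have hcoord : ∀ x : E d, fderiv ℝ (fun x : E d => x i) x (EuclideanSpace.single i 1) = 1 := by
    intro x
    have : (fun x : E d => x i) = EuclideanSpace.proj (𝕜 := ℝ) i := by ext; simp
    rw [this, ContinuousLinearMap.fderiv]
    simp
  have hs : HasCompactSupport fun x => φ x * φ x := h2.mul_left
  -- Since `∂_i x_i = 1`, write `φ²` as `φ² ∂_i x_i` and move the derivative onto `φ²`.
  have key := integral_mul_fderiv_eq_neg_fderiv_mul_of_integrable (μ := (volume : Measure (E d)))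
    (f := fun x => φ x * φ x) (g := fun x : E d => x i) (v := EuclideanSpace.single i (1 : ℝ))
    ?_ ?_ ?_ (fun x _ => (hd x).mul (hd x)) (fun x _ => by fun_prop)
  · simp only [hcoord, hder, mul_one] at key
    rw [key]
    congr 1
    refine integral_congr_ae (ae_of_all _ fun x => ?_)
    ring
  · simp only [hder]
    refine Continuous.integrable_of_hasCompactSupport (by fun_prop) ?_
    exact HasCompactSupport.mul_right (HasCompactSupport.mul_left (h2.mul_right))
  · simp only [hcoord, mul_one]
    exact Continuous.integrable_of_hasCompactSupport (by fun_prop) hs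
  · exact Continuous.integrable_of_hasCompactSupport (by fun_prop) hs.mul_right

/-- Integration by parts gives `‖φ‖² = -⟨φ, 2 x_i ∂_i φ⟩`. As `|x_i| ≤ R` on `D`, Cauchy–Schwarz and
division by `‖φ‖` finish. -/
theorem norm_fst_le_of_mem_testPairs {R : ℝ} (hDm : MeasurableSet D) (hR : ∀ x ∈ D, ‖x‖ ≤ R)
    (i : Fin d) {p : L2Pair D} (hp : p ∈ testPairs D) : ‖p.fst‖ ≤ 2 * R * ‖p.snd‖ := by
  obtain ⟨φ, h1, h2, h3, h4, h5⟩ := hp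
  let μ := (volume : Measure (E d)).restrict D
  -- This is `2 x_i ∂_i φ`, expressed through the `L²` gradient so that its norm is bounded by that
  -- of `p.snd`.
  let k : E d → ℝ := fun x => 2 * x i * inner ℝ (p.snd x) (EuclideanSpace.single i (1 : ℝ))
  have hk_le : ∀ᵐ x ∂μ, ‖k x‖ ≤ 2 * R * ‖p.snd x‖ := by
    filter_upwards [ae_restrict_mem hDm] with x hx
    have ha : ‖x i‖ ≤ R := (PiLp.norm_apply_le x i).trans (hR x hx)
    have hb : ‖inner ℝ (p.snd x) (EuclideanSpace.single i (1 : ℝ))‖ ≤ ‖p.snd x‖ := by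
      simpa using norm_inner_le_norm (𝕜 := ℝ) (p.snd x) (EuclideanSpace.single i (1 : ℝ))
    simp only [k, norm_mul, Real.norm_ofNat]
    have hR0 : 0 ≤ R := (norm_nonneg _).trans ha
    gcongr
  have hkm : AEStronglyMeasurable k μ := by
    refine AEStronglyMeasurable.mul (by fun_prop) ?_
    exact (Lp.memLp p.snd).1.inner aestronglyMeasurable_const
  have hkL : MemLp k 2 μ := (Lp.memLp p.snd).of_le_mul hkm hk_le
  have hknorm : ‖hkL.toLp k‖ ≤ 2 * R * ‖p.snd‖ := by
    refine Lp.norm_le_mul_norm_of_ae_le_mul ?_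
    filter_upwards [hk_le, hkL.coeFn_toLp] with x hx hx'
    rwa [hx']
  have hz : ∀ x, x ∉ D → φ x = 0 := fun x hx => image_eq_zero_of_notMem_tsupport fun h => hx (h3 h)
  have hsub : ∀ g : E d → ℝ, ∫ x, φ x * g x = ∫ x in D, φ x * g x := fun g =>
    (setIntegral_eq_integral_of_forall_compl_eq_zero fun x hx => by rw [hz x hx, zero_mul]).symm
  have e1 : inner ℝ p.fst p.fst = ∫ x, φ x * φ x := by
    rw [L2.inner_def, hsub]
    refine integral_congr_ae ?_
    filter_upwards [h4] with x hx
    rw [hx]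
    rfl
  have e2 : inner ℝ p.fst (hkL.toLp k) =
      ∫ x, φ x * (2 * x i * fderiv ℝ φ x (EuclideanSpace.single i 1)) := by
    rw [L2.inner_def, hsub]
    refine integral_congr_ae ?_
    filter_upwards [h4, h5, hkL.coeFn_toLp] with x hx hx5 hxk
    have : inner ℝ (gradient φ x) (EuclideanSpace.single i (1 : ℝ)) =
        fderiv ℝ φ x (EuclideanSpace.single i 1) := by
      simp only [gradient]
      exact InnerProductSpace.toDual_symm_apply
    rw [hx, hxk]
    simp only [k]
    rw [hx5, this]
    simp [mul_comm]
  have e3 : ‖p.fst‖ * ‖p.fst‖ ≤ ‖p.fst‖ * (2 * R * ‖p.snd‖) := by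
    rw [← real_inner_self_eq_norm_mul_norm, e1, integral_sq_eq_neg_integral h1 h2 i, ← e2]
    calc -inner ℝ p.fst (hkL.toLp k) ≤ ‖p.fst‖ * ‖hkL.toLp k‖ :=
          (neg_le_abs _).trans (abs_real_inner_le_norm _ _)
      _ ≤ _ := by gcongr
  rcases (norm_nonneg p.fst).eq_or_lt with h | h
  · rw [← h]
    exact (norm_nonneg _).trans hknorm
  · exact le_of_mul_le_mul_left e3 h

/-- The gradient of `u ∈ H¹₀(D)` as an element of `L²(D)ᵈ`. -/
noncomputable def gradL (D : Set (E d)) : H10 D →L[ℝ] Lp (E d) 2 (volume.restrict D) :=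
  (WithLp.sndL 2 ℝ (Lp ℝ 2 (volume.restrict D)) (Lp (E d) 2 (volume.restrict D))).comp
    (H10 D).subtypeL

/-- The Poincaré inequality on a bounded open set. -/
theorem exists_norm_le_norm_gradL (hd : 0 < d) (hD : IsOpen D) (hb : Bornology.IsBounded D) :
    ∃ C : ℝ, 0 < C ∧ ∀ u : H10 D, ‖u‖ ≤ C * ‖gradL D u‖ := by
  obtain ⟨R, hR0, hR⟩ := hb.exists_pos_norm_le
  have key : ∀ p : L2Pair D, p ∈ H10 D → ‖p.fst‖ ≤ 2 * R * ‖p.snd‖ := by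
    intro p hp
    have hcl : IsClosed {p : L2Pair D | ‖p.fst‖ ≤ 2 * R * ‖p.snd‖} := by
      refine isClosed_le ?_ ?_
      · exact (WithLp.fstL 2 ℝ _ _).continuous.norm
      · exact continuous_const.mul (WithLp.sndL 2 ℝ _ _).continuous.norm
    exact closure_minimal (fun q hq => norm_fst_le_of_mem_testPairs hD.measurableSet hR ⟨0, hd⟩ hq)
      hcl hp
  -- The full norm also contains the gradient, and `(2R)² + 1 ≤ (2R + 1)²`.
  refine ⟨2 * R + 1, by positivity, fun u => ?_⟩
  have h := key u.1 u.2
  have h2 : ‖u‖ ^ 2 = ‖u.1.fst‖ ^ 2 + ‖u.1.snd‖ ^ 2 := WithLp.prod_norm_sq_eq_of_L2 u.1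
  change ‖u‖ ≤ (2 * R + 1) * ‖u.1.snd‖
  have h0 := norm_nonneg u.1.snd
  refine (sq_le_sq₀ (norm_nonneg _) (by positivity)).1 ?_
  rw [h2]
  nlinarith [pow_le_pow_left₀ (norm_nonneg u.1.fst) h 2, mul_nonneg hR0.le (sq_nonneg ‖u.1.snd‖)]

end Poincare

/-! ### Multiplication by bounded functions on `L²` -/

section Weighted

variable {α F : Type*} [MeasurableSpace α] {μ : Measure α} [NormedAddCommGroup F]
  [InnerProductSpace ℝ F] {a : α → ℝ} {M : ℝ}

theorem memLp_smul_of_abs_le (ha : AEStronglyMeasurable a μ) (hM : ∀ᵐ x ∂μ, |a x| ≤ M)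
    (g : Lp F 2 μ) : MemLp (fun x => a x • g x) 2 μ := by
  refine (Lp.memLp g).of_le_mul (c := M) (ha.smul (Lp.memLp g).1) ?_
  filter_upwards [hM] with x hx
  rw [norm_smul]
  gcongr
  exact hx

/-- Multiplication by a bounded measurable function as an operator on `L²`. -/
noncomputable def mulL2 (ha : AEStronglyMeasurable a μ) (hM : ∀ᵐ x ∂μ, |a x| ≤ M) :
    Lp F 2 μ →L[ℝ] Lp F 2 μ :=
  LinearMap.mkContinuous
    { toFun := fun g => (memLp_smul_of_abs_le ha hM g).toLp _
      map_add' := fun g h => by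
        ext1
        filter_upwards [Lp.coeFn_add g h, (memLp_smul_of_abs_le ha hM g).coeFn_toLp,
          (memLp_smul_of_abs_le ha hM h).coeFn_toLp,
          (memLp_smul_of_abs_le ha hM (g + h)).coeFn_toLp,
          Lp.coeFn_add ((memLp_smul_of_abs_le ha hM g).toLp _)
            ((memLp_smul_of_abs_le ha hM h).toLp _)] with x h1 h2 h3 h4 h5
        rw [h4, h5, Pi.add_apply, h2, h3, h1, Pi.add_apply, smul_add]
      map_smul' := fun c g => by
        ext1
        filter_upwards [Lp.coeFn_smul c g, (memLp_smul_of_abs_le ha hM g).coeFn_toLp,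
          (memLp_smul_of_abs_le ha hM (c • g)).coeFn_toLp,
          Lp.coeFn_smul c ((memLp_smul_of_abs_le ha hM g).toLp _)] with x h1 h2 h3 h4
        rw [h3, RingHom.id_apply, h4, Pi.smul_apply, h2, h1, Pi.smul_apply, smul_comm] }
    M fun g => by
      refine Lp.norm_le_mul_norm_of_ae_le_mul ?_
      filter_upwards [hM, (memLp_smul_of_abs_le ha hM g).coeFn_toLp] with x hx hx'
      refine (congrArg norm hx').trans_le ?_
      rw [norm_smul]
      gcongr
      exact hx

theorem mulL2_coeFn (ha : AEStronglyMeasurable a μ) (hM : ∀ᵐ x ∂μ, |a x| ≤ M) (g : Lp F 2 μ) :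
    mulL2 ha hM g =ᵐ[μ] fun x => a x • g x :=
  (memLp_smul_of_abs_le ha hM g).coeFn_toLp

theorem norm_mulL2_le (ha : AEStronglyMeasurable a μ) (hM : ∀ᵐ x ∂μ, |a x| ≤ M) (g : Lp F 2 μ) :
    ‖mulL2 ha hM g‖ ≤ M * ‖g‖ := by
  refine Lp.norm_le_mul_norm_of_ae_le_mul ?_
  filter_upwards [hM, mulL2_coeFn ha hM g] with x hx hx'
  rw [hx', norm_smul]
  gcongr
  exact hx

theorem inner_mulL2 (ha : AEStronglyMeasurable a μ) (hM : ∀ᵐ x ∂μ, |a x| ≤ M) (g h : Lp F 2 μ) :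
    inner ℝ (mulL2 ha hM g) h = ∫ x, a x * inner ℝ (g x) (h x) ∂μ := by
  rw [L2.inner_def]
  refine integral_congr_ae ?_
  filter_upwards [mulL2_coeFn ha hM g] with x hx
  rw [hx, real_inner_smul_left]

theorem integrable_mul_inner (ha : AEStronglyMeasurable a μ) (hM : ∀ᵐ x ∂μ, |a x| ≤ M)
    (g h : Lp F 2 μ) : Integrable (fun x => a x * inner ℝ (g x) (h x)) μ :=
  (L2.integrable_inner (𝕜 := ℝ) g h).bdd_mul ha hM

theorem abs_integral_mul_inner_le (ha : AEStronglyMeasurable a μ) (hM : ∀ᵐ x ∂μ, |a x| ≤ M)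
    (g h : Lp F 2 μ) : |∫ x, a x * inner ℝ (g x) (h x) ∂μ| ≤ M * ‖g‖ * ‖h‖ := by
  rw [← inner_mulL2 ha hM]
  exact (abs_real_inner_le_norm _ _).trans (by gcongr; exact norm_mulL2_le ha hM g)

theorem mul_norm_sq_le_integral_mul_inner {m : ℝ} (ha : AEStronglyMeasurable a μ)
    (hm : ∀ᵐ x ∂μ, m ≤ a x) (hM : ∀ᵐ x ∂μ, |a x| ≤ M) (g : Lp F 2 μ) :
    m * ‖g‖ ^ 2 ≤ ∫ x, a x * inner ℝ (g x) (g x) ∂μ := by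
  rw [← real_inner_self_eq_norm_sq, L2.inner_def, ← integral_const_mul]
  refine integral_mono_ae ((L2.integrable_inner (𝕜 := ℝ) g g).const_mul m)
    (integrable_mul_inner ha hM g g) ?_
  filter_upwards [hm] with x hx
  exact mul_le_mul_of_nonneg_right hx real_inner_self_nonneg

end Weighted

/-! ### Well-posedness and stability of the elliptic problem -/

section Elliptic

variable {d : ℕ} {D : Set (E d)} {a b : E d → ℝ} {m M : ℝ} {f : StrongDual ℝ (H10 D)}

/-- `a` is measurable on `D` with values in `[m, M]`, where `m > 0`. -/
structure IsAdmissible (D : Set (E d)) (a : E d → ℝ) (m M : ℝ) : Prop where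
  measurable : AEStronglyMeasurable a (volume.restrict D)
  pos : 0 < m
  ge : ∀ᵐ x ∂volume.restrict D, m ≤ a x
  abs_le : ∀ᵐ x ∂volume.restrict D, |a x| ≤ M

/-- The bilinear form `∫_D a ∇u·∇v dx` of an elliptic operator. -/
noncomputable def IsAdmissible.form (h : IsAdmissible D a m M) : H10 D →L[ℝ] H10 D →L[ℝ] ℝ :=
  (innerSL ℝ).bilinearComp ((mulL2 h.measurable h.abs_le).comp (gradL D)) (gradL D)

theorem IsAdmissible.form_apply (h : IsAdmissible D a m M) (u v : H10 D) :
    h.form u v = ∫ x in D, a x * inner ℝ (grad u x) (grad v x) :=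
  inner_mulL2 h.measurable h.abs_le (gradL D u) (gradL D v)

theorem IsAdmissible.le_form (h : IsAdmissible D a m M) (u : H10 D) :
    m * ‖gradL D u‖ ^ 2 ≤ h.form u u := by
  rw [h.form_apply]
  exact mul_norm_sq_le_integral_mul_inner h.measurable h.ge h.abs_le (gradL D u)

/-- Ellipticity controls only the gradient; the Poincaré inequality upgrades this to the full norm,
with constant `m / C²`. -/
theorem IsAdmissible.isCoercive (h : IsAdmissible D a m M) {C : ℝ} (hC : 0 < C)
    (hP : ∀ u : H10 D, ‖u‖ ≤ C * ‖gradL D u‖) : IsCoercive h.form := by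
  have hm := h.pos
  refine ⟨m / C ^ 2, by positivity, fun u => ?_⟩
  refine le_trans ?_ (h.le_form u)
  have := pow_le_pow_left₀ (norm_nonneg u) (hP u) 2
  calc m / C ^ 2 * ‖u‖ * ‖u‖ = m / C ^ 2 * ‖u‖ ^ 2 := by ring
    _ ≤ m / C ^ 2 * (C * ‖gradL D u‖) ^ 2 := by gcongr
    _ = m * ‖gradL D u‖ ^ 2 := by field_simp

instance : CompleteSpace (H10 D) :=
  (Submodule.isClosed_topologicalClosure _).completeSpace_coe

/-- The Lax–Milgram theorem. -/
theorem _root_.IsCoercive.existsUnique {V : Type*} [NormedAddCommGroup V] [InnerProductSpace ℝ V]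
    [CompleteSpace V] {B : V →L[ℝ] V →L[ℝ] ℝ} (hB : IsCoercive B) (f : StrongDual ℝ V) :
    ∃! u : V, ∀ v, B u v = f v := by
  -- Representing both sides by Riesz vectors turns the variational equation into an equation for an
  -- invertible operator.
  have key : ∀ u, (∀ v, B u v = f v) ↔
      hB.continuousLinearEquivOfBilin u = (InnerProductSpace.toDual ℝ V).symm f := by
    intro u
    constructor
    · intro hu
      refine ext_inner_right ℝ fun v => ?_
      rw [hB.continuousLinearEquivOfBilin_apply, InnerProductSpace.toDual_symm_apply]
      exact hu v
    · intro hu v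
      rw [← hB.continuousLinearEquivOfBilin_apply, hu, InnerProductSpace.toDual_symm_apply]
  refine ⟨hB.continuousLinearEquivOfBilin.symm ((InnerProductSpace.toDual ℝ V).symm f),
    (key _).2 (by simp), fun u hu => ?_⟩
  rw [← (key u).1 hu]
  simp

theorem IsAdmissible.existsUnique_isWeakSolution (h : IsAdmissible D a m M) {C : ℝ} (hC : 0 < C)
    (hP : ∀ u : H10 D, ‖u‖ ≤ C * ‖gradL D u‖) (f : StrongDual ℝ (H10 D)) :
    ∃! u : H10 D, IsWeakSolution a f u := by
  have := (h.isCoercive hC hP).existsUnique f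
  simp only [h.form_apply] at this
  exact this

theorem mul_le_of_mul_sq_le_mul {m k x : ℝ} (hx : 0 ≤ x) (hk : 0 ≤ k) (h : m * x ^ 2 ≤ k * x) :
    x * m ≤ k := by
  rcases hx.eq_or_lt with h0 | h0
  · rwa [← h0, zero_mul]
  · nlinarith

/-- The energy estimate. -/
theorem IsAdmissible.norm_gradL_le (h : IsAdmissible D a m M) {C : ℝ} (hC : 0 < C)
    (hP : ∀ u : H10 D, ‖u‖ ≤ C * ‖gradL D u‖) {u : H10 D} (hu : IsWeakSolution a f u) :
    ‖gradL D u‖ ≤ C * ‖f‖ / m := by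
  have h1 : m * ‖gradL D u‖ ^ 2 ≤ C * ‖f‖ * ‖gradL D u‖ := by
    calc m * ‖gradL D u‖ ^ 2 ≤ f u := by rw [← hu u, ← h.form_apply]; exact h.le_form u
      _ ≤ ‖f‖ * ‖u‖ := (le_abs_self _).trans (f.le_opNorm u)
      _ ≤ ‖f‖ * (C * ‖gradL D u‖) := by gcongr; exact hP u
      _ = _ := by ring
  rw [le_div_iff₀ h.pos]
  exact mul_le_of_mul_sq_le_mul (norm_nonneg _) (by positivity) h1

/-- Continuous dependence of the solution on the coefficient. -/
theorem IsAdmissible.norm_gradL_sub_le (h : IsAdmissible D a m M)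
    {m' M' : ℝ} (h' : IsAdmissible D b m' M') {η : ℝ} (hη : 0 ≤ η)
    (hab : ∀ᵐ x ∂volume.restrict D, |b x - a x| ≤ η) {u v : H10 D}
    (hu : IsWeakSolution a f u) (hv : IsWeakSolution b f v) :
    ‖gradL D u - gradL D v‖ ≤ η * ‖gradL D v‖ / m := by
  set w := u - v with hw
  have hgw : gradL D u - gradL D v = gradL D w := (map_sub (gradL D) u v).symm
  rw [hgw]
  -- Both solutions have the same right hand side, so `∫ a ∇u·∇w = ∫ b ∇v·∇w`; subtract `∫ a ∇v·∇w`.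
  have h1 : h.form w w = ∫ x in D, (b x - a x) * inner ℝ (gradL D v x) (gradL D w x) := by
    have e1 : h.form u w = h'.form v w := by
      rw [h.form_apply, h'.form_apply, hu, hv]
    have e2 : h.form w w = h.form u w - h.form v w := by
      have := DFunLike.congr_fun (map_sub h.form u v) w
      exact this
    have i1 := integrable_mul_inner h'.measurable h'.abs_le (gradL D v) (gradL D w)
    have i2 := integrable_mul_inner h.measurable h.abs_le (gradL D v) (gradL D w)
    have i3 := integral_sub i1 i2
    rw [e2, e1, h.form_apply, h'.form_apply]
    have i4 : ∀ x, b x * inner ℝ (gradL D v x) (gradL D w x) -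
        a x * inner ℝ (gradL D v x) (gradL D w x) =
        (b x - a x) * inner ℝ (gradL D v x) (gradL D w x) := fun x => (sub_mul _ _ _).symm
    simp only [i4] at i3
    exact i3.symm
  have h2 := h.le_form w
  have h3 := abs_integral_mul_inner_le (h'.measurable.sub h.measurable) hab (gradL D v) (gradL D w)
  have h4 : m * ‖gradL D w‖ ^ 2 ≤ η * ‖gradL D v‖ * ‖gradL D w‖ := by
    rw [h1] at h2
    exact h2.trans ((le_abs_self _).trans h3)
  rw [le_div_iff₀ h.pos]
  exact mul_le_of_mul_sq_le_mul (norm_nonneg _) (mul_nonneg hη (norm_nonneg _)) h4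

end Elliptic

namespace GaussianProblem

/-! ### The space `U`, its weight and the prior -/

section Prior

variable {d N : ℕ} (P : GaussianProblem d N)

/-- The extended nonnegative form makes the sum measurable without convergence questions and opens
it to Tonelli's theorem. -/
theorem mem_U_iff (z : ℕ → ℝ) :
    z ∈ P.U ↔ ∑' j, ‖z j‖ₑ * ENNReal.ofReal (supAbs P.D (P.psi j)) ≠ ⊤ := by
  have h : ∀ j, ‖z j‖ₑ * ENNReal.ofReal (supAbs P.D (P.psi j)) =
      ENNReal.ofReal (|z j| * supAbs P.D (P.psi j)) := fun j => by
    rw [ENNReal.ofReal_mul (abs_nonneg _), Real.enorm_eq_ofReal_abs]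
  simp only [h]
  have h0 : ∀ j, 0 ≤ |z j| * supAbs P.D (P.psi j) := fun j =>
    mul_nonneg (abs_nonneg _) (supAbs_nonneg _ _)
  refine ⟨fun hz => (ENNReal.ofReal_tsum_of_nonneg h0 hz) ▸ ENNReal.ofReal_ne_top, fun hz => ?_⟩
  have := ENNReal.summable_toReal hz
  simp only [ENNReal.toReal_ofReal (h0 _)] at this
  exact this

theorem measurableSet_U : MeasurableSet P.U := by
  have : P.U = {z | ∑' j, ‖z j‖ₑ * ENNReal.ofReal (supAbs P.D (P.psi j)) ≠ ⊤} := by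
    ext z
    exact P.mem_U_iff z
  rw [this]
  exact (measurableSet_singleton ⊤).compl.preimage
    (Measurable.tsum fun j => (measurable_pi_apply j).enorm.mul_const _)

instance : IsProbabilityMeasure gaussianSeq := by
  unfold gaussianSeq
  infer_instance

theorem lintegral_enorm_gaussianSeq (j : ℕ) :
    ∫⁻ z, ‖z j‖ₑ ∂gaussianSeq = ∫⁻ x, ‖x‖ₑ ∂(gaussianReal 0 1) :=
  (measurePreserving_eval_infinitePi (fun _ : ℕ => gaussianReal 0 1) j).lintegral_comp
    measurable_enorm

/-- By Tonelli the weight has expectation `E|ξ| ∑ b_j < ∞` with `ξ` standard normal, so it is almost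
surely finite. Independence plays no role. -/
theorem ae_mem_U : ∀ᵐ z ∂gaussianSeq, z ∈ P.U := by
  have h1 : ∫⁻ z, ∑' j, ‖z j‖ₑ * ENNReal.ofReal (supAbs P.D (P.psi j)) ∂gaussianSeq ≠ ⊤ := by
    rw [lintegral_tsum fun j => ((measurable_pi_apply j).enorm.mul_const _).aemeasurable]
    have h2 : ∀ j, ∫⁻ z, ‖z j‖ₑ * ENNReal.ofReal (supAbs P.D (P.psi j)) ∂gaussianSeq =
        (∫⁻ x, ‖x‖ₑ ∂(gaussianReal 0 1)) * ENNReal.ofReal (supAbs P.D (P.psi j)) := fun j => by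
      rw [lintegral_mul_const _ (measurable_pi_apply j).enorm, lintegral_enorm_gaussianSeq]
    simp only [h2]
    rw [ENNReal.tsum_mul_left,
      ← ENNReal.ofReal_tsum_of_nonneg (fun j => supAbs_nonneg _ _) P.psi_summable]
    have h3 : Integrable (fun x : ℝ => x) (gaussianReal 0 1) := IsGaussian.integrable_fun_id
    exact ENNReal.mul_ne_top h3.2.ne ENNReal.ofReal_ne_top
  filter_upwards [ae_lt_top
    (Measurable.tsum fun j => (measurable_pi_apply j).enorm.mul_const _) h1] with z hz
  exact (P.mem_U_iff z).2 hz.ne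

theorem gaussianSeq_U : gaussianSeq P.U = 1 :=
  (prob_compl_eq_zero_iff P.measurableSet_U).1 (mem_ae_iff.1 P.ae_mem_U)

instance : IsProbabilityMeasure P.prior := by
  refine isProbabilityMeasure_comap Subtype.val_injective ?_ fun s hs =>
    P.measurableSet_U.subtype_image hs
  simpa using P.ae_mem_U

/-- The weighted norm `∑_j |z_j| sup |ψ_j|` of the space `U`. -/
noncomputable def weight (z : ℕ → ℝ) : ℝ := ∑' j, |z j| * supAbs P.D (P.psi j)

theorem weight_nonneg (z : ℕ → ℝ) : 0 ≤ P.weight z :=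
  tsum_nonneg fun _ => mul_nonneg (abs_nonneg _) (supAbs_nonneg _ _)

theorem measurable_weight : Measurable fun z : P.U => P.weight z := by
  refine measurable_of_tendsto_metrizable
    (f := fun n (z : P.U) => ∑ j ∈ Finset.range n, |z.1 j| * supAbs P.D (P.psi j)) ?_ ?_
  · intro n
    exact Finset.measurable_fun_sum _ fun j _ =>
      ((measurable_pi_apply j).comp measurable_subtype_coe).norm.mul_const _
  · exact tendsto_pi_nhds.2 fun z => Summable.tendsto_sum_tsum_nat z.2

variable {P} {z w : ℕ → ℝ}

theorem sub_mem_U (hz : z ∈ P.U) (hw : w ∈ P.U) : z - w ∈ P.U := by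
  refine Summable.of_nonneg_of_le (fun j => mul_nonneg (abs_nonneg _) (supAbs_nonneg _ _))
    (fun j => ?_) (hz.add hw)
  rw [← add_mul]
  exact mul_le_mul_of_nonneg_right (abs_sub _ _) (supAbs_nonneg _ _)

theorem weight_le_add (hz : z ∈ P.U) (hw : w ∈ P.U) :
    P.weight w ≤ P.weight z + P.weight (w - z) := by
  have hs : w - z ∈ P.U := sub_mem_U hw hz
  unfold weight
  rw [← Summable.tsum_add hz hs]
  refine Summable.tsum_le_tsum (fun j => ?_) hw (hz.add hs)
  rw [← add_mul]
  refine mul_le_mul_of_nonneg_right ?_ (supAbs_nonneg _ _)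
  calc |w j| = |z j + (w - z) j| := by simp
    _ ≤ _ := abs_add_le _ _

theorem abs_mul_psi_le (z : ℕ → ℝ) {x : E d} (hx : x ∈ P.D) (y : E d) (j : ℕ) :
    ‖z j * P.psi j x y‖ ≤ |z j| * supAbs P.D (P.psi j) := by
  rw [norm_mul]
  exact mul_le_mul_of_nonneg_left ((P.psi_mem j).abs_le_supAbs P.D_bounded hx y) (abs_nonneg _)

theorem summable_mul_psi (hz : z ∈ P.U) {x : E d} (hx : x ∈ P.D) (y : E d) :
    Summable fun j => z j * P.psi j x y :=
  Summable.of_norm_bounded hz (abs_mul_psi_le z hx y)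

theorem abs_tsum_mul_psi_le (hz : z ∈ P.U) {x : E d} (hx : x ∈ P.D) (y : E d) :
    |∑' j, z j * P.psi j x y| ≤ P.weight z :=
  tsum_of_norm_bounded (f := fun j => z j * P.psi j x y) (Summable.hasSum hz)
    (abs_mul_psi_le z hx y)

/-- For `t ≤ s` one has `e^s - e^t = e^s (1 - e^(t-s))`, and `1 - e^(t-s) ≤ s - t`. -/
theorem abs_exp_sub_exp_le {s t K : ℝ} (hs : s ≤ K) (ht : t ≤ K) :
    |Real.exp s - Real.exp t| ≤ Real.exp K * |s - t| := by
  have key : ∀ s t : ℝ, s ≤ K → t ≤ K → t ≤ s →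
      |Real.exp s - Real.exp t| ≤ Real.exp K * |s - t| := by
    intro s t hs ht h
    rw [abs_of_nonneg (sub_nonneg.2 (Real.exp_le_exp.2 h)), abs_of_nonneg (sub_nonneg.2 h)]
    have h1 : Real.exp t = Real.exp s * Real.exp (t - s) := by
      rw [← Real.exp_add]
      ring_nf
    have h2 := Real.add_one_le_exp (t - s)
    calc Real.exp s - Real.exp t = Real.exp s * (1 - Real.exp (t - s)) := by rw [h1]; ring
      _ ≤ Real.exp s * (s - t) := by
        refine mul_le_mul_of_nonneg_left ?_ (Real.exp_pos s).le
        linarith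
      _ ≤ _ := mul_le_mul_of_nonneg_right (Real.exp_le_exp.2 hs) (sub_nonneg.2 h)
  rcases le_total t s with h | h
  · exact key s t hs ht h
  · rw [abs_sub_comm, abs_sub_comm s]
    exact key t s ht hs h

end Prior

/-! ### Bounds, continuity and measurability of the forward map -/

section Forward

variable {d N : ℕ} (P : GaussianProblem d N)

theorem exists_abs_Abar_le : ∃ B : ℝ, ∀ x ∈ P.D, ∀ y, |P.Abar x y| ≤ B := by
  obtain ⟨B, -, hB⟩ := P.Abar_mem.exists_norm_le P.D_bounded
  exact ⟨B, fun x hx => hB x (subset_closure hx)⟩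

variable {P} {z w : ℕ → ℝ}

theorem abs_exponent_le {B : ℝ} (hB : ∀ x ∈ P.D, ∀ y, |P.Abar x y| ≤ B) (hz : z ∈ P.U) {x : E d}
    (hx : x ∈ P.D) (y : E d) :
    |P.Abar x y + ∑' j, z j * P.psi j x y| ≤ B + P.weight z :=
  (abs_add_le _ _).trans (add_le_add (hB x hx y) (abs_tsum_mul_psi_le hz hx y))

/-- `A^*` cancels and the exponents differ by the series of `w - z`. For fixed `z` the bound depends
on `w` only through the weight of `w - z`, and vanishes with it. -/
theorem abs_coeff_sub_le {B : ℝ} (hB : ∀ x ∈ P.D, ∀ y, |P.Abar x y| ≤ B) (hz : z ∈ P.U)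
    (hw : w ∈ P.U) {x : E d} (hx : x ∈ P.D) (y : E d) :
    |P.coeff w x y - P.coeff z x y| ≤
      Real.exp (B + P.weight z + P.weight (w - z)) * P.weight (w - z) := by
  have h1 : P.coeff w x y - P.coeff z x y = Real.exp (P.Abar x y + ∑' j, w j * P.psi j x y) -
      Real.exp (P.Abar x y + ∑' j, z j * P.psi j x y) := by
    unfold coeff
    ring
  have h2 : (P.Abar x y + ∑' j, w j * P.psi j x y) - (P.Abar x y + ∑' j, z j * P.psi j x y) =
      ∑' j, (w - z) j * P.psi j x y := by
    rw [add_sub_add_left_eq_sub,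
      ← Summable.tsum_sub (summable_mul_psi hw hx y) (summable_mul_psi hz hx y)]
    simp only [Pi.sub_apply, sub_mul]
  have h3 := (le_abs_self _).trans (abs_exponent_le hB hz hx y)
  have h4 := (le_abs_self _).trans (abs_exponent_le hB hw hx y)
  have h5 := weight_le_add hz hw
  have h6 := P.weight_nonneg (w - z)
  rw [h1]
  refine (abs_exp_sub_exp_le (K := B + P.weight z + P.weight (w - z)) (by linarith)
    (by linarith)).trans ?_
  rw [h2]
  exact mul_le_mul_of_nonneg_left (abs_tsum_mul_psi_le (sub_mem_U hw hz) hx y) (Real.exp_pos _).le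

theorem continuousOn_coeff (hz : z ∈ P.U) (c : ℝ) :
    ContinuousOn (fun x => P.coeff z x (c • x)) P.D := by
  unfold coeff
  refine (P.Astar_mem.continuousOn_twoScale c).add ?_
  refine Real.continuous_exp.comp_continuousOn ((P.Abar_mem.continuousOn_twoScale c).add ?_)
  exact continuousOn_tsum
    (fun j => continuousOn_const.mul ((P.psi_mem j).continuousOn_twoScale c)) hz
    fun j x hx => abs_mul_psi_le z hx _ j

/-- The lower bound is explicit and free of the scale `c` because it alone enters the energy
estimates; the upper bound serves only to make the form bounded. -/
theorem exists_isAdmissible_coeff {B : ℝ} (hB : ∀ x ∈ P.D, ∀ y, |P.Abar x y| ≤ B)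
    (hz : z ∈ P.U) (c : ℝ) :
    ∃ M, IsAdmissible P.D (fun x => P.coeff z x (c • x)) (Real.exp (-(B + P.weight z))) M := by
  obtain ⟨K, hK0, hK⟩ := P.Astar_mem.exists_norm_le P.D_bounded
  have hA : ∀ x ∈ P.D, ∀ y, 0 ≤ P.Astar x y := fun x hx y =>
    P.Astar_mem.mem_of_forall_unitCube (subset_closure hx) isClosed_Ici (P.Astar_nonneg x hx) y
  refine ⟨K + Real.exp (B + P.weight z),
    (continuousOn_coeff hz c).aestronglyMeasurable P.D_open.measurableSet, Real.exp_pos _, ?_, ?_⟩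
  · filter_upwards [ae_restrict_mem P.D_open.measurableSet] with x hx
    have h := abs_le.1 (abs_exponent_le hB hz hx (c • x))
    exact (Real.exp_le_exp.2 h.1).trans (le_add_of_nonneg_left (hA x hx _))
  · filter_upwards [ae_restrict_mem P.D_open.measurableSet] with x hx
    have h := abs_le.1 (abs_exponent_le hB hz hx (c • x))
    refine (abs_add_le _ _).trans (add_le_add (hK x (subset_closure hx) _) ?_)
    rw [abs_of_pos (Real.exp_pos _)]
    exact Real.exp_le_exp.2 h.2

variable (P) in
theorem existsUnique_isForwardSolution (ε : ℝ) (z : P.U) :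
    ∃! u : H10 P.D, P.IsForwardSolution ε z u := by
  obtain ⟨B, hB⟩ := P.exists_abs_Abar_le
  obtain ⟨C, hC, hP⟩ := exists_norm_le_norm_gradL P.d_pos P.D_open P.D_bounded
  obtain ⟨M, hM⟩ := exists_isAdmissible_coeff hB z.2 ε⁻¹
  exact hM.existsUnique_isWeakSolution hC hP P.f

theorem isForwardSolution_solution (ε : ℝ) (z : P.U) :
    P.IsForwardSolution ε z (P.solution ε z) := by
  have h := (P.existsUnique_isForwardSolution ε z).exists
  unfold solution
  rw [dif_pos h]
  exact h.choose_spec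

variable (P) in
/-- Bounds on the gradient of the solution that are uniform in `ε`. -/
theorem exists_norm_gradL_solution_le : ∃ B C : ℝ, 0 ≤ C ∧ ∀ (ε : ℝ) (z : P.U),
    ‖gradL P.D (P.solution ε z)‖ ≤ C * Real.exp (B + P.weight z) ∧
    ∀ w : P.U, ‖gradL P.D (P.solution ε z) - gradL P.D (P.solution ε w)‖ ≤
      Real.exp (B + P.weight z + P.weight (w.1 - z.1)) * P.weight (w.1 - z.1) *
        (C * Real.exp (B + P.weight w)) * Real.exp (B + P.weight z) := by
  obtain ⟨B, hB⟩ := P.exists_abs_Abar_le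
  obtain ⟨C, hC, hP⟩ := exists_norm_le_norm_gradL P.d_pos P.D_open P.D_bounded
  have h1 : ∀ (ε : ℝ) (z : P.U),
      ‖gradL P.D (P.solution ε z)‖ ≤ C * ‖P.f‖ * Real.exp (B + P.weight z) := by
    intro ε z
    obtain ⟨M, hM⟩ := exists_isAdmissible_coeff hB z.2 ε⁻¹
    have := hM.norm_gradL_le hC hP (isForwardSolution_solution ε z)
    rwa [Real.exp_neg, div_inv_eq_mul] at this
  refine ⟨B, C * ‖P.f‖, by positivity, fun ε z => ⟨h1 ε z, fun w => ?_⟩⟩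
  obtain ⟨M, hM⟩ := exists_isAdmissible_coeff hB z.2 ε⁻¹
  obtain ⟨M', hM'⟩ := exists_isAdmissible_coeff hB w.2 ε⁻¹
  have hη : 0 ≤ Real.exp (B + P.weight z + P.weight (w.1 - z.1)) * P.weight (w.1 - z.1) :=
    mul_nonneg (Real.exp_pos _).le (P.weight_nonneg _)
  have h2 := hM.norm_gradL_sub_le hM' hη ?_ (isForwardSolution_solution ε z)
    (isForwardSolution_solution ε w)
  · rw [Real.exp_neg, div_inv_eq_mul] at h2
    refine h2.trans (mul_le_mul_of_nonneg_right ?_ (Real.exp_pos _).le)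
    exact mul_le_mul_of_nonneg_left (h1 ε w) hη
  · filter_upwards [ae_restrict_mem P.D_open.measurableSet] with x hx
    exact abs_coeff_sub_le hB z.2 w.2 hx _

variable (P) in
/-- The observation functionals are bounded on `L²(D)ᵈ`, uniformly in the scale. -/
theorem exists_observation_clm : ∃ C : ℝ, 0 ≤ C ∧ ∀ c : ℝ,
    ∃ T : Lp (E d) 2 (volume.restrict P.D) →L[ℝ] E N, (∀ g, ‖T g‖ ≤ C * ‖g‖) ∧
      ∀ g, T g = WithLp.toLp 2 fun i => ∫ x in P.D, inner ℝ (P.ell i x (c • x)) (g x) := by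
  have : IsFiniteMeasure (volume.restrict P.D) :=
    isFiniteMeasure_restrict.2 P.D_bounded.measure_lt_top.ne
  choose M hM0 hM using fun i => (P.ell_mem i).exists_norm_le P.D_bounded
  -- `V = |D|^(1/2)`, the factor between a sup bound and an `L²` norm on `D`.
  let V : ℝ := (measureUnivNNReal (volume.restrict P.D) : ℝ) ^ (2 : ℝ≥0∞).toReal⁻¹
  have hV : 0 ≤ V := by positivity
  refine ⟨∑ i, V * M i, Finset.sum_nonneg fun i _ => mul_nonneg hV (hM0 i), fun c => ?_⟩
  have hbd : ∀ i, ∀ᵐ x ∂volume.restrict P.D, ‖P.ell i x (c • x)‖ ≤ M i := fun i => by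
    filter_upwards [ae_restrict_mem P.D_open.measurableSet] with x hx
    exact hM i x (subset_closure hx) _
  have hL : ∀ i, MemLp (fun x => P.ell i x (c • x)) 2 (volume.restrict P.D) := fun i =>
    MemLp.of_bound (((P.ell_mem i).continuousOn_twoScale c).aestronglyMeasurable
      P.D_open.measurableSet) (M i) (hbd i)
  have hn : ∀ i, ‖(hL i).toLp‖ ≤ V * M i := fun i => by
    refine Lp.norm_le_of_ae_bound (hM0 i) ?_
    filter_upwards [hbd i, (hL i).coeFn_toLp] with x hx hx'
    rwa [hx']
  refine ⟨(EuclideanSpace.equiv (Fin N) ℝ).symm.toContinuousLinearMap.comp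
    (ContinuousLinearMap.pi fun i => innerSL ℝ (hL i).toLp), fun g => ?_, fun g => ?_⟩
  · set v := ((EuclideanSpace.equiv (Fin N) ℝ).symm.toContinuousLinearMap.comp
      (ContinuousLinearMap.pi fun i => innerSL ℝ (hL i).toLp)) g
    have hv : ∀ i, ‖v i‖ ≤ V * M i * ‖g‖ := fun i => by
      refine (abs_real_inner_le_norm (hL i).toLp g).trans ?_
      exact mul_le_mul_of_nonneg_right (hn i) (norm_nonneg _)
    calc ‖v‖ ≤ ∑ i, ‖v i‖ := by
          rw [EuclideanSpace.norm_eq]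
          refine Real.sqrt_le_iff.2 ⟨Finset.sum_nonneg fun i _ => norm_nonneg _, ?_⟩
          exact Finset.sum_sq_le_sq_sum_of_nonneg fun i _ => norm_nonneg _
      _ ≤ ∑ i, V * M i * ‖g‖ := Finset.sum_le_sum fun i _ => hv i
      _ = _ := by rw [Finset.sum_mul]
  · ext i
    change inner ℝ (hL i).toLp g = ∫ x in P.D, inner ℝ (P.ell i x (c • x)) (g x)
    rw [L2.inner_def]
    refine integral_congr_ae ?_
    filter_upwards [(hL i).coeFn_toLp] with x hx
    rw [hx]

variable (P) in
/-- Bounds on the forward map that are uniform in `ε`. -/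
theorem exists_norm_forward_le : ∃ B C : ℝ, 0 ≤ C ∧ ∀ (ε : ℝ) (z : P.U),
    ‖P.forward ε z‖ ≤ C * Real.exp (B + P.weight z) ∧
    ∀ w : P.U, ‖P.forward ε z - P.forward ε w‖ ≤
      Real.exp (B + P.weight z + P.weight (w.1 - z.1)) * P.weight (w.1 - z.1) *
        (C * Real.exp (B + (P.weight z + P.weight (w.1 - z.1)))) * Real.exp (B + P.weight z) := by
  obtain ⟨B, C, hC, h⟩ := P.exists_norm_gradL_solution_le
  obtain ⟨K, hK, hT⟩ := P.exists_observation_clm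
  refine ⟨B, K * C, by positivity, fun ε z => ?_⟩
  obtain ⟨T, hTn, hTe⟩ := hT ε⁻¹
  have hf : ∀ z, P.forward ε z = T (gradL P.D (P.solution ε z)) := fun z => (hTe _).symm
  obtain ⟨h1, h2⟩ := h ε z
  refine ⟨?_, fun w => ?_⟩
  · rw [hf, mul_assoc]
    exact (hTn _).trans (mul_le_mul_of_nonneg_left h1 hK)
  · rw [hf, hf, ← map_sub]
    refine (hTn _).trans ((mul_le_mul_of_nonneg_left (h2 w) hK).trans ?_)
    -- Eliminates the weight of `w`, so that the bound becomes a continuous function of the weight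
    -- of `w - z`.
    have h3 : Real.exp (B + P.weight w) ≤ Real.exp (B + (P.weight z + P.weight (w.1 - z.1))) :=
      Real.exp_le_exp.2 (add_le_add le_rfl (weight_le_add z.2 w.2))
    have h4 := P.weight_nonneg (w.1 - z.1)
    calc _ = Real.exp (B + P.weight z + P.weight (w.1 - z.1)) * P.weight (w.1 - z.1) *
        (K * C * Real.exp (B + P.weight w)) * Real.exp (B + P.weight z) := by ring
      _ ≤ _ := by gcongr

/-- The forward map is continuous with respect to the weighted norm. -/
theorem tendsto_forward {α : Type*} {l : Filter α} (ε : ℝ) (z : P.U) (w : α → P.U)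
    (h : Tendsto (fun a => P.weight ((w a).1 - z.1)) l (𝓝 0)) :
    Tendsto (fun a => P.forward ε (w a)) l (𝓝 (P.forward ε z)) := by
  obtain ⟨B, C, hC, hf⟩ := P.exists_norm_forward_le
  rw [tendsto_iff_norm_sub_tendsto_zero]
  have hcont : Continuous fun t : ℝ => Real.exp (B + P.weight z + t) * t *
        (C * Real.exp (B + (P.weight z + t))) * Real.exp (B + P.weight z) := by fun_prop
  have h0 := (hcont.tendsto 0).comp h
  simp only [mul_zero, zero_mul] at h0
  refine squeeze_zero (fun a => norm_nonneg _) (fun a => ?_) h0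
  rw [norm_sub_rev]
  exact (hf ε z).2 (w a)

/-- Cutting off a sequence after `n` terms. -/
def truncate (n : ℕ) (z : ℕ → ℝ) : ℕ → ℝ := fun j => if j < n then z j else 0

theorem weight_truncate_sub (n : ℕ) (z w : ℕ → ℝ) :
    P.weight (truncate n z - truncate n w) =
      ∑ j ∈ Finset.range n, |z j - w j| * supAbs P.D (P.psi j) := by
  unfold weight
  rw [tsum_eq_sum (s := Finset.range n)]
  · refine Finset.sum_congr rfl fun j hj => ?_
    simp [truncate, Finset.mem_range.1 hj]
  · intro j hj
    simp [truncate, Finset.mem_range.not.1 hj]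

theorem truncate_mem_U (n : ℕ) (z : ℕ → ℝ) : truncate n z ∈ P.U := by
  refine summable_of_ne_finset_zero (s := Finset.range n) fun j hj => ?_
  simp [truncate, Finset.mem_range.not.1 hj]

/-- The truncation error is the tail of the convergent series defining the weight. -/
theorem tendsto_weight_truncate_sub (hz : z ∈ P.U) :
    Tendsto (fun n => P.weight (truncate n z - z)) atTop (𝓝 0) := by
  have h : ∀ n, P.weight (truncate n z - z) =
      P.weight z - ∑ j ∈ Finset.range n, |z j| * supAbs P.D (P.psi j) := by
    intro n
    have h1 : P.weight (truncate n z) = ∑ j ∈ Finset.range n, |z j| * supAbs P.D (P.psi j) := by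
      have := weight_truncate_sub (P := P) n z 0
      have h0 : truncate n (0 : ℕ → ℝ) = 0 := by
        ext j
        simp [truncate]
      simpa [h0] using this
    rw [eq_sub_iff_add_eq, ← h1]
    unfold weight
    rw [← Summable.tsum_add (sub_mem_U (truncate_mem_U n z) hz) (truncate_mem_U n z)]
    refine tsum_congr fun j => ?_
    by_cases hj : j < n <;> simp [truncate, hj]
  simp only [h]
  have := (Summable.tendsto_sum_tsum_nat (show Summable _ from hz)).const_sub (P.weight z)
  rwa [weight, sub_self] at this

variable (P) in
-- Continuity is known in the weighted distance, whereas `U` carries the product structure. Between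
-- truncations the weighted distance is a finite sum, hence continuous in the product topology, and
-- the forward map is the pointwise limit along truncations.
theorem measurable_forward (ε : ℝ) : Measurable (P.forward ε) := by
  refine measurable_of_tendsto_metrizable
    (f := fun n (z : P.U) => P.forward ε ⟨truncate n z.1, truncate_mem_U n z.1⟩) (fun n => ?_) ?_
  · refine Continuous.measurable (continuous_iff_continuousAt.2 fun z => ?_)
    refine tendsto_forward ε ⟨truncate n z.1, truncate_mem_U n z.1⟩ _ ?_
    simp only [weight_truncate_sub]
    have hc : Continuous fun w : P.U =>
        ∑ j ∈ Finset.range n, |w.1 j - z.1 j| * supAbs P.D (P.psi j) :=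
      continuous_finsetSum _ fun j _ => (((continuous_apply j).comp continuous_subtype_val).sub
        continuous_const).abs.mul continuous_const
    simpa using hc.tendsto z
  · exact tendsto_pi_nhds.2 fun z => tendsto_forward ε z _ (tendsto_weight_truncate_sub z.2)

end Forward

end GaussianProblem

/-! ### Bayes' formula for additive noise with a density -/

section Bayes

variable {X F : Type*} [MeasurableSpace X] [AddGroup F] [MeasureSpace F] [MeasurableAdd₂ F]
  [MeasurableNeg F] [SFinite (volume : Measure F)] [(volume : Measure F).IsAddLeftInvariant]
  {ρ : Measure X} [SFinite ρ] {G : X → F} {p : F → ℝ≥0∞}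

/-- The law of `(x, G x + ν)` has the density `p(-G x + δ)`. -/
theorem lintegral_prod_withDensity_comp_add (hG : Measurable G) (hp : Measurable p)
    {h : F × X → ℝ≥0∞} (hh : Measurable h) :
    ∫⁻ q, h (G q.1 + q.2, q.1) ∂(ρ.prod ((volume : Measure F).withDensity p)) =
      ∫⁻ δ, ∫⁻ x, p (-G x + δ) * h (δ, x) ∂ρ := by
  have hm : Measurable fun q : X × F => p (-G q.1 + q.2) * h (q.2, q.1) :=
    (hp.comp ((hG.comp measurable_fst).neg.add measurable_snd)).mul (hh.comp measurable_swap)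
  have hm' : Measurable fun q : X × F => h (G q.1 + q.2, q.1) :=
    hh.comp (((hG.comp measurable_fst).add measurable_snd).prodMk measurable_fst)
  rw [lintegral_prod _ hm'.aemeasurable, ← lintegral_lintegral_swap (μ := ρ)
    (f := fun x δ => p (-G x + δ) * h (δ, x)) hm.aemeasurable]
  refine lintegral_congr fun x => ?_
  have hx : Measurable fun v => h (G x + v, x) :=
    hh.comp ((measurable_const_add _).prodMk measurable_const)
  -- For fixed `x` substitute `δ = G x + v`, using translation invariance.
  rw [lintegral_withDensity_eq_lintegral_mul _ hp hx,
    ← lintegral_add_left_eq_self (fun δ => p (-G x + δ) * h (δ, x)) (G x)]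
  simp only [Pi.mul_apply, neg_add_cancel_left]

/-- Bayes' formula for an observation with additive noise that has the density `p`. -/
theorem map_observation_eq_compProd (hG : Measurable G) (hp : Measurable p) {k : F → X → ℝ≥0∞}
    (hk : Measurable (Function.uncurry k)) {κ : Kernel F X} [IsSFiniteKernel κ]
    (hκ : ∀ δ, κ δ = ρ.withDensity (k δ))
    (hpk : ∀ δ x, (∫⁻ x', p (-G x' + δ) ∂ρ) * k δ x = p (-G x + δ)) :
    (ρ.prod ((volume : Measure F).withDensity p)).map (fun q => (G q.1 + q.2, q.1)) =
      ((ρ.prod ((volume : Measure F).withDensity p)).map fun q => G q.1 + q.2) ⊗ₘ κ := by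
  have hobs : Measurable fun q : X × F => G q.1 + q.2 := (hG.comp measurable_fst).add measurable_snd
  refine Measure.ext_of_lintegral _ fun h hh => ?_
  rw [lintegral_map hh (hobs.prodMk measurable_fst), Measure.lintegral_compProd hh,
    lintegral_map hh.lintegral_kernel_prod_right' hobs,
    lintegral_prod_withDensity_comp_add hG hp hh,
    lintegral_prod_withDensity_comp_add (h := fun q => ∫⁻ b, h (q.1, b) ∂κ q.1) hG hp
      (hh.lintegral_kernel_prod_right'.comp measurable_fst)]
  refine lintegral_congr fun δ => ?_
  have hpδ : Measurable fun x => p (-G x + δ) := hp.comp (hG.neg.add_const _)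
  have hkδ : Measurable (k δ) := hk.comp measurable_prodMk_left
  have hhδ : Measurable fun x => h (δ, x) := hh.comp measurable_prodMk_left
  dsimp only
  rw [lintegral_mul_const _ hpδ, hκ, lintegral_withDensity_eq_lintegral_mul _ hkδ hhδ,
    ← lintegral_const_mul _ (hkδ.mul hhδ)]
  -- Pointwise, the evidence at `δ` times the normalized density `k` is the unnormalized density.
  refine lintegral_congr fun x => ?_
  rw [← hpk δ x, Pi.mul_apply, mul_assoc]

end Bayes

/-! ### Likelihood, normalizing constant and posterior -/

namespace GaussianProblem

variable {d N : ℕ} (P : GaussianProblem d N)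

/-- With `W = Σ^(-1/2)`, nonnegativity, measurability and Lipschitz bounds of the misfit reduce to
facts about the norm of a linear image. -/
theorem exists_sigmaNormSq_eq :
    ∃ W : E N →L[ℝ] E N, ∀ v, P.sigmaNormSq v = ‖W v‖ ^ 2 :=
  ⟨_, fun v => (P.cov_posDef.norm_sq_inv_sqrt v).symm⟩

theorem measurable_misfit (ε : ℝ) :
    Measurable fun q : E N × P.U => P.misfit ε q.2 q.1 := by
  obtain ⟨W, hW⟩ := P.exists_sigmaNormSq_eq
  simp only [misfit, hW]
  have h := (P.measurable_forward ε).comp (measurable_snd : Measurable (Prod.snd : E N × P.U → P.U))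
  exact ((W.continuous.measurable.comp (measurable_fst.sub h)).norm.pow_const 2).const_mul _

theorem misfit_nonneg (ε : ℝ) (z : P.U) (δ : E N) : 0 ≤ P.misfit ε z δ := by
  obtain ⟨W, hW⟩ := P.exists_sigmaNormSq_eq
  simp only [misfit, hW]
  positivity

theorem measurable_likelihood (ε : ℝ) :
    Measurable fun q : E N × P.U => Real.exp (-P.misfit ε q.2 q.1) :=
  (P.measurable_misfit ε).neg.exp

theorem integrable_likelihood (ε : ℝ) (δ : E N) :
    Integrable (fun z => Real.exp (-P.misfit ε z δ)) P.prior := by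
  refine Integrable.of_bound
    ((P.measurable_likelihood ε).comp measurable_prodMk_left).aestronglyMeasurable 1
    (ae_of_all _ fun z => ?_)
  rw [Real.norm_of_nonneg (Real.exp_pos _).le]
  exact Real.exp_le_one_iff.2 (neg_nonpos.2 (P.misfit_nonneg ε z δ))

theorem normConst_pos (ε : ℝ) (δ : E N) : 0 < P.normConst ε δ :=
  integral_exp_pos (P.integrable_likelihood ε δ)

theorem measurable_normConst (ε : ℝ) : Measurable (P.normConst ε) :=
  ((P.measurable_likelihood ε).stronglyMeasurable.integral_prod_right'
    (ν := P.prior)).measurable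

theorem ofReal_normConst (ε : ℝ) (δ : E N) : ENNReal.ofReal (P.normConst ε δ) =
    ∫⁻ z, ENNReal.ofReal (Real.exp (-P.misfit ε z δ)) ∂P.prior :=
  ofReal_integral_eq_lintegral_ofReal (P.integrable_likelihood ε δ)
    (ae_of_all _ fun _ => (Real.exp_pos _).le)

theorem measurable_posteriorDensity (ε : ℝ) :
    Measurable (Function.uncurry fun (δ : E N) (z : P.U) =>
      ENNReal.ofReal (Real.exp (-P.misfit ε z δ) / P.normConst ε δ)) :=
  ((P.measurable_likelihood ε).div ((P.measurable_normConst ε).comp measurable_fst)).ennreal_ofReal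

/-- The posterior measures as a Markov kernel. -/
noncomputable def bayesKernel (ε : ℝ) : Kernel (E N) P.U :=
  (Kernel.const (E N) P.prior).withDensity fun δ z =>
    ENNReal.ofReal (Real.exp (-P.misfit ε z δ) / P.normConst ε δ)

theorem bayesKernel_apply (ε : ℝ) (δ : E N) : P.bayesKernel ε δ = P.bayesMeasure ε δ := by
  rw [bayesKernel, Kernel.withDensity_apply _ (P.measurable_posteriorDensity ε)]
  rfl

instance (ε : ℝ) : IsMarkovKernel (P.bayesKernel ε) := by
  refine ⟨fun δ => ⟨?_⟩⟩
  rw [bayesKernel_apply, bayesMeasure, withDensity_apply _ MeasurableSet.univ,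
    Measure.restrict_univ, ← ofReal_integral_eq_lintegral_ofReal
      ((P.integrable_likelihood ε δ).div_const _)
      (ae_of_all _ fun z => (div_pos (Real.exp_pos _) (P.normConst_pos ε δ)).le),
    integral_div]
  change ENNReal.ofReal (P.normConst ε δ / P.normConst ε δ) = 1
  rw [div_self (P.normConst_pos ε δ).ne', ENNReal.ofReal_one]

/-- The noise density at `δ - G` is the likelihood times a constant `c`, which cancels in the
normalization, so its value is irrelevant. -/
theorem isPosterior_bayesKernel (ε : ℝ) : P.IsPosterior ε (P.bayesKernel ε) := by
  obtain ⟨c, hc, hν⟩ := exists_multivariateGaussian_eq_withDensity P.cov_posDef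
  let p : E N → ℝ≥0∞ := fun v => ENNReal.ofReal (c * Real.exp (-(1 / 2 * P.sigmaNormSq v)))
  have hp : Measurable p := by
    obtain ⟨W, hW⟩ := P.exists_sigmaNormSq_eq
    simp only [p, hW]
    fun_prop
  have hpe : ∀ δ z, p (-P.forward ε z + δ) =
      ENNReal.ofReal c * ENNReal.ofReal (Real.exp (-P.misfit ε z δ)) := fun δ z => by
    rw [← ENNReal.ofReal_mul hc.le, neg_add_eq_sub]
    rfl
  have hobs : Measurable (P.observation ε) :=
    ((P.measurable_forward ε).comp measurable_fst).add measurable_snd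
  refine ⟨inferInstance, (hobs.prodMk measurable_fst).aemeasurable, ?_⟩
  unfold jointLaw
  rw [hν]
  refine map_observation_eq_compProd (P.measurable_forward ε) hp
    (P.measurable_posteriorDensity ε) (P.bayesKernel_apply ε) fun δ z => ?_
  have hZ := P.normConst_pos ε δ
  simp only [hpe]
  have hm : Measurable fun z => ENNReal.ofReal (Real.exp (-P.misfit ε z δ)) :=
    ((P.measurable_likelihood ε).comp measurable_prodMk_left).ennreal_ofReal
  rw [lintegral_const_mul _ hm, ← ofReal_normConst, mul_assoc, ← ENNReal.ofReal_mul hZ.le, mul_div_cancel₀ _ hZ.ne']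

/-- Both kernels disintegrate the same joint law of `(δ, z)` over the law of `δ`, and on a countably
generated σ-algebra such a disintegration is unique almost everywhere. -/
theorem IsPosterior.ae_eq {P : GaussianProblem d N} {ε : ℝ} {κ κ' : Kernel (E N) P.U}
    (hκ : P.IsPosterior ε κ) (hκ' : P.IsPosterior ε κ') :
    ∀ᵐ δ ∂(P.jointLaw.map (P.observation ε)), κ δ = κ' δ := by
  have h1 := hκ.1
  have h2 := hκ'.1
  have : IsFiniteMeasure P.jointLaw := by
    unfold jointLaw
    infer_instance
  exact Kernel.ae_eq_of_compProd_eq (hκ.2.map_eq.symm.trans hκ'.2.map_eq)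

/-! ### Lipschitz dependence on the data -/

/-- The derivative has modulus `(|x|/2) exp(-x²/4) ≤ 1`, since `|x|/2 ≤ 1 + x²/4 ≤ exp(x²/4)`. -/
theorem abs_exp_neg_sq_sub_le (s t : ℝ) :
    |Real.exp (-(s ^ 2 / 4)) - Real.exp (-(t ^ 2 / 4))| ≤ |s - t| := by
  have hd : ∀ x : ℝ, HasDerivAt (fun x : ℝ => Real.exp (-(x ^ 2 / 4)))
      (Real.exp (-(x ^ 2 / 4)) * (-(x / 2))) x := fun x => by
    have h : HasDerivAt (fun x : ℝ => -(x ^ 2 / 4)) (-(x / 2)) x := by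
      refine ((hasDerivAt_pow 2 x).div_const 4).fun_neg.congr_deriv ?_
      norm_num
      ring
    exact h.exp
  have hb : ∀ x : ℝ, ‖deriv (fun x : ℝ => Real.exp (-(x ^ 2 / 4))) x‖ ≤ 1 := fun x => by
    rw [(hd x).deriv, norm_mul, norm_neg, Real.norm_of_nonneg (Real.exp_pos _).le, Real.exp_neg,
      inv_mul_le_iff₀ (Real.exp_pos _), mul_one, Real.norm_eq_abs]
    refine le_trans ?_ (Real.add_one_le_exp _)
    rw [abs_le]
    constructor <;> nlinarith [sq_nonneg (x - 1), sq_nonneg (x + 1)]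
  have := convex_univ.norm_image_sub_le_of_norm_deriv_le (x := t) (y := s)
    (fun x _ => (hd x).differentiableAt) (fun x _ => hb x) trivial trivial
  simpa using this

/-- The square root of the likelihood is Lipschitz in the data, uniformly in the unknown. -/
theorem exists_abs_sqrt_likelihood_sub_le : ∃ L : ℝ, 0 ≤ L ∧ ∀ (ε : ℝ) (z : P.U) (δ δ' : E N),
    |√(Real.exp (-P.misfit ε z δ)) - √(Real.exp (-P.misfit ε z δ'))| ≤ L * ‖δ - δ'‖ := by
  obtain ⟨W, hW⟩ := P.exists_sigmaNormSq_eq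
  refine ⟨‖W‖, norm_nonneg _, fun ε z δ δ' => ?_⟩
  have h : ∀ δ, √(Real.exp (-P.misfit ε z δ)) =
      Real.exp (-(‖W (δ - P.forward ε z)‖ ^ 2 / 4)) := fun δ => by
    rw [← Real.exp_half, misfit, hW]
    ring_nf
  rw [h, h]
  calc _ ≤ |‖W (δ - P.forward ε z)‖ - ‖W (δ' - P.forward ε z)‖| := abs_exp_neg_sq_sub_le _ _
    _ ≤ ‖W (δ - P.forward ε z) - W (δ' - P.forward ε z)‖ := abs_norm_sub_norm_le _ _
    -- The forward value cancels, which makes the constant independent of `z` and `ε`.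
    _ = ‖W (δ - δ')‖ := by rw [← map_sub, sub_sub_sub_cancel_right]
    _ ≤ _ := W.le_opNorm _

/-- A lower bound of the normalizing constant that is uniform in `ε`. -/
theorem exists_le_normConst (r : ℝ) : ∃ Z₀ : ℝ, 0 < Z₀ ∧ ∀ (ε : ℝ) (δ : E N), ‖δ‖ ≤ r →
    Z₀ ≤ P.normConst ε δ := by
  obtain ⟨W, hW⟩ := P.exists_sigmaNormSq_eq
  obtain ⟨B, C, hC, hf⟩ := P.exists_norm_forward_le
  -- The worst exponent allowed by `‖δ‖ ≤ r` and the bound on the forward map. It is finite for each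
  -- `z` and free of `ε`, so its exponential has a positive integral.
  let K : P.U → ℝ := fun z => -(1 / 2 * (‖W‖ * (r + C * Real.exp (B + P.weight z))) ^ 2)
  have hK : Integrable (fun z => Real.exp (K z)) P.prior := by
    refine Integrable.of_bound (Measurable.aestronglyMeasurable ?_) 1 (ae_of_all _ fun z => ?_)
    · have := P.measurable_weight
      fun_prop
    · rw [Real.norm_of_nonneg (Real.exp_pos _).le]
      refine Real.exp_le_one_iff.2 (neg_nonpos.2 ?_)
      positivity
  refine ⟨_, integral_exp_pos hK, fun ε δ hδ => ?_⟩
  refine integral_mono hK (P.integrable_likelihood ε δ) fun z => ?_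
  refine Real.exp_le_exp.2 (neg_le_neg ?_)
  rw [misfit, hW]
  have h1 : ‖W (δ - P.forward ε z)‖ ≤ ‖W‖ * (r + C * Real.exp (B + P.weight z)) :=
    (W.le_opNorm _).trans (mul_le_mul_of_nonneg_left
      ((norm_sub_le _ _).trans (add_le_add hδ (hf ε z).1)) (norm_nonneg _))
  gcongr

/-- Here `h`, `h'` are roots of likelihoods and `s`, `s'` roots of normalizing constants. From `s² -
s'² = (s - s')(s + s')` and `s + s' ≥ 2 s₀` one gets `|s - s'| ≤ η / s₀`; then split the difference
of quotients into a change of numerator and a change of denominator. -/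
theorem abs_div_sub_div_le {h h' s s' s₀ η : ℝ} (hs₀ : 0 < s₀) (hs : s₀ ≤ s) (hs' : s₀ ≤ s')
    (h0' : 0 ≤ h') (h1' : h' ≤ 1) (hh : |h - h'| ≤ η) (hss : |s ^ 2 - s' ^ 2| ≤ 2 * η) :
    |h / s - h' / s'| ≤ (1 / s₀ + 1 / s₀ ^ 3) * η := by
  have hs0 : 0 < s := hs₀.trans_le hs
  have hs0' : 0 < s' := hs₀.trans_le hs'
  have hη : 0 ≤ η := (abs_nonneg _).trans hh
  have h1 : |s' - s| ≤ η / s₀ := by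
    rw [le_div_iff₀ hs₀]
    have : |s ^ 2 - s' ^ 2| = |s' - s| * (s + s') := by
      rw [← abs_of_pos (add_pos hs0 hs0'), ← abs_mul, ← abs_neg]
      ring_nf
    nlinarith [abs_nonneg (s' - s)]
  have h2 : h / s - h' / s' = (h - h') / s + h' * (s' - s) / (s * s') := by
    field_simp
    ring
  have h3 : |(h - h') / s| ≤ η / s₀ := by
    rw [abs_div, abs_of_pos hs0]
    gcongr
  have h4 : |h' * (s' - s) / (s * s')| ≤ 1 * (η / s₀) / (s₀ * s₀) := by
    rw [abs_div, abs_mul, abs_of_nonneg h0', abs_of_pos (mul_pos hs0 hs0')]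
    gcongr
  rw [h2]
  refine (abs_add_le _ _).trans ((add_le_add h3 h4).trans (le_of_eq ?_))
  field_simp

theorem hellinger_bayesMeasure (ε : ℝ) (δ δ' : E N) :
    P.hellinger (P.bayesMeasure ε δ) (P.bayesMeasure ε δ') =
      √(1 / 2 * ∫ z, (√(Real.exp (-P.misfit ε z δ)) / √(P.normConst ε δ) -
        √(Real.exp (-P.misfit ε z δ')) / √(P.normConst ε δ')) ^ 2 ∂P.prior) := by
  have h : ∀ δ, ∀ᵐ z ∂P.prior, √((P.bayesMeasure ε δ).rnDeriv P.prior z).toReal =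
      √(Real.exp (-P.misfit ε z δ)) / √(P.normConst ε δ) := fun δ => by
    have hm : Measurable fun z : P.U =>
        ENNReal.ofReal (Real.exp (-P.misfit ε z δ) / P.normConst ε δ) :=
      (P.measurable_posteriorDensity ε).of_uncurry_left
    filter_upwards [Measure.rnDeriv_withDensity P.prior hm] with z hz
    rw [bayesMeasure, hz, ENNReal.toReal_ofReal
      (div_pos (Real.exp_pos _) (P.normConst_pos ε δ)).le, Real.sqrt_div (Real.exp_pos _).le]
  unfold hellinger
  congr 2
  refine integral_congr_ae ?_
  filter_upwards [h δ, h δ'] with z hz hz'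
  rw [hz, hz']

/-- The roots of the two posterior densities differ by at most `c ‖δ - δ'‖` pointwise, and the prior
has mass one. -/
theorem exists_hellinger_le (r : ℝ) : ∃ c : ℝ, ∀ (ε : ℝ) (δ δ' : E N), ‖δ‖ ≤ r → ‖δ'‖ ≤ r →
    P.hellinger (P.bayesMeasure ε δ) (P.bayesMeasure ε δ') ≤ c * ‖δ - δ'‖ := by
  obtain ⟨L, hL, hlip⟩ := P.exists_abs_sqrt_likelihood_sub_le
  obtain ⟨Z₀, hZ₀, hZ⟩ := P.exists_le_normConst r
  refine ⟨(1 / √Z₀ + 1 / √Z₀ ^ 3) * L, fun ε δ δ' hδ hδ' => ?_⟩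
  have h1 : ∀ (z : P.U) (δ : E N), √(Real.exp (-P.misfit ε z δ)) ≤ 1 := fun z δ =>
    Real.sqrt_le_one.2 (Real.exp_le_one_iff.2 (neg_nonpos.2 (P.misfit_nonneg ε z δ)))
  -- The likelihood is the square of its root; factoring the difference of squares gives the 2, as
  -- both roots are at most 1.
  have hZZ : |P.normConst ε δ - P.normConst ε δ'| ≤ 2 * (L * ‖δ - δ'‖) := by
    unfold normConst
    rw [← integral_sub (P.integrable_likelihood ε δ) (P.integrable_likelihood ε δ')]
    have := norm_integral_le_of_norm_le_const (μ := P.prior) (C := 2 * (L * ‖δ - δ'‖))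
      (f := fun z => Real.exp (-P.misfit ε z δ) - Real.exp (-P.misfit ε z δ'))
      (ae_of_all _ fun z => ?_)
    · simpa using this
    have e : ∀ δ, Real.exp (-P.misfit ε z δ) = √(Real.exp (-P.misfit ε z δ)) ^ 2 := fun δ =>
      (Real.sq_sqrt (Real.exp_pos _).le).symm
    rw [e δ, e δ', sq_sub_sq, norm_mul]
    refine mul_le_mul ?_ (hlip ε z δ δ') (abs_nonneg _) zero_le_two
    rw [Real.norm_of_nonneg (by positivity)]
    linarith [h1 z δ, h1 z δ']
  set A : ℝ := (1 / √Z₀ + 1 / √Z₀ ^ 3) * L * ‖δ - δ'‖ with hA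
  have hA0 : 0 ≤ A := by positivity
  have hpt : ∀ z, ‖(√(Real.exp (-P.misfit ε z δ)) / √(P.normConst ε δ) -
      √(Real.exp (-P.misfit ε z δ')) / √(P.normConst ε δ')) ^ 2‖ ≤ A ^ 2 := fun z => by
    rw [norm_pow]
    refine pow_le_pow_left₀ (norm_nonneg _) ?_ 2
    rw [hA, mul_assoc]
    refine abs_div_sub_div_le (Real.sqrt_pos.2 hZ₀) (Real.sqrt_le_sqrt (hZ ε δ hδ))
      (Real.sqrt_le_sqrt (hZ ε δ' hδ')) (Real.sqrt_nonneg _) (h1 z δ') (hlip ε z δ δ') ?_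
    rwa [Real.sq_sqrt (P.normConst_pos ε δ).le, Real.sq_sqrt (P.normConst_pos ε δ').le]
  rw [hellinger_bayesMeasure]
  refine Real.sqrt_le_iff.2 ⟨hA0, ?_⟩
  have := (le_abs_self _).trans
    (norm_integral_le_of_norm_le_const (μ := P.prior) (ae_of_all _ hpt))
  simp only [probReal_univ, mul_one] at this
  nlinarith [sq_nonneg A]

end GaussianProblem

end TwoScale

theorem proposition5p1 {d N : ℕ} (P : TwoScale.GaussianProblem d N) :
    -- the prior is a probability measure on the set `U` of full measure
    (MeasurableSet P.U ∧ TwoScale.gaussianSeq P.U = 1 ∧ IsProbabilityMeasure P.prior) ∧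
    (∀ ε : ℝ, 0 < ε →
      -- the forward problem is well posed and the forward map is measurable
      (∀ z : P.U, ∃! u : TwoScale.H10 P.D, P.IsForwardSolution ε z u) ∧
      Measurable (P.forward ε) ∧
      -- the posterior `P(z | δ)` exists, is given by the Bayes formula, and is unique
      (∀ δ : TwoScale.E N, 0 < P.normConst ε δ) ∧
      (∃ κ : Kernel (TwoScale.E N) P.U, P.IsPosterior ε κ ∧
        ∀ δ : TwoScale.E N, κ δ = P.bayesMeasure ε δ) ∧
      (∀ κ : Kernel (TwoScale.E N) P.U, P.IsPosterior ε κ →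
        ∀ᵐ δ ∂(P.jointLaw.map (P.observation ε)), κ δ = P.bayesMeasure ε δ)) ∧
    -- local Lipschitz dependence on the data, uniformly in `ε`
    (∀ r : ℝ, 0 < r → ∃ c : ℝ, ∀ ε : ℝ, 0 < ε → ∀ δ δ' : TwoScale.E N,
      ‖δ‖ ≤ r → ‖δ'‖ ≤ r →
        P.hellinger (P.bayesMeasure ε δ) (P.bayesMeasure ε δ') ≤ c * ‖δ - δ'‖) := by
  refine ⟨⟨P.measurableSet_U, P.gaussianSeq_U, inferInstance⟩, fun ε _ =>
    ⟨P.existsUnique_isForwardSolution ε, P.measurable_forward ε, P.normConst_pos ε,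
      ⟨P.bayesKernel ε, P.isPosterior_bayesKernel ε, P.bayesKernel_apply ε⟩, fun κ hκ => ?_⟩,
    fun r _ => ?_⟩
  · simpa only [P.bayesKernel_apply ε] using hκ.ae_eq (P.isPosterior_bayesKernel ε)
  · obtain ⟨c, hc⟩ := P.exists_hellinger_le r
    exact ⟨c, fun ε _ => hc ε⟩
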